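/- Let $\mathcal{R}$ be a countable nonsingular equivalence relation on a standard probability space $(X,\mu)$: $\mathcal{R}\subset X\times X$ is Borel, its classes are countable, and the $\mathcal{R}$-saturation of every $\mu$-null Borel set is $\mu$-null. Call $\mathcal{R}$ \emph{treeable} if there is a Borel graph $\mathcal{T}$ on $X$ with $\mathcal{T}\subset\mathcal{R}$ such that for $\mu$-a.e. $x\in X$ the connected component of $x$ in $\mathcal{T}$ is a tree with vertex set the $\mathcal{R}$-class of $x$. A \emph{discrete measured groupoid} $\mathcal{G}$ with unit space $\mathcal{G}^{(0)}=X$ is a groupoid that is a standard Borel space, with $X\subset\mathcal{G}$ Borel, with Borel countable-to-one source and target maps $s,t:\mathcal{G}\to X$, with Borel multiplication $(g,h)\mapsto gh$ on $\{(g,h)\mid s(g)=t(h)\}$ and Borel inversion, and such that the measures $\mu_s$ and $\mu_t$ on $\mathcal{G}$, given by integrating with respect to $\mu$ the counting measures on the fibers of $s$ and of $t$, are equivalent. Denote its isotropy groups by $\Gamma_x=\{g\in\mathcal{G}\mid s(g)=t(g)=x\}$. Assume that $\mathcal{R}=\{(t(g),s(g))\mid g\in\mathcal{G}\}$. An action of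 $\mathcal{R}$ on the field $(\Gamma_x)_{x\in X}$ is a Borel family of group isomorphisms $\delta_{(x,y)}:\Gamma_y\to\Gamma_x$, $(x,y)\in\mathcal{R}$, with $\delta_{(x,y)}\circ\delta_{(y,z)}=\delta_{(x,z)}$. The associated semidirect product is the groupoid with unit space $X$ and arrows $((x,y),g)$, where $(x,y)\in\mathcal{R}$ and $g\in\Gamma_x$, with source $y$, target $x$ and product $((x,y),g)\,((y,z),h)=((x,z),\,g\,\delta_{(x,y)}(h))$. We say that $\mathcal{G}$ can be written as a semidirect product of $\mathcal{R}$ acting on its field of isotropy groups if, after restricting $\mathcal{G}$ and $\mathcal{R}$ to some $\mathcal{R}$-invariant Borel set of full measure in $X$, there are such an action and a Borel groupoid isomorphism of the associated semidirect product onto $\mathcal{G}$ that is the identity on units and satisfies $((x,x),g)\mapsto g$ for all $x$ and all $g\in\Gamma_x$. Then the following two statements are equivalent. 1. $\mathcal{R}$ is treeable. 2. Every discrete measured groupoid $\mathcal{G}$ with $\mathcal{G}^{(0)}=X$ and $\mathcal{R}=\{(t(g),s(g))\mid g\in\mathcal{G}\}$ can be written as a semidirect product of $\mathcal{R}$ acting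 on the field of isotropy groups of $\mathcal{G}$. -/

import Mathlib

open MeasureTheory

universe u

/-! ### Countable nonsingular equivalence relations and treeability -/

/-- `R` is a countable nonsingular (Borel) equivalence relation on the measure space `(X, μ)`:
`R` is a Borel subset of `X × X`, all equivalence classes are countable, and the `R`-saturation of
every `μ`-null Borel set is `μ`-null. -/
structure IsCountableNonsingular {X : Type u} [MeasurableSpace X] (R : Setoid X)
    (μ : Measure X) : Prop where
  measurableSet_rel : MeasurableSet {p : X × X | R p.1 p.2}
  countable_class : ∀ x : X, {y : X | R y x}.Countable
  null_saturation : ∀ N : Set X, MeasurableSet N → μ N = 0 → μ {x : X | ∃ y ∈ N, R x y} = 0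

/-- `R` is treeable: there is a Borel graph `T` on `X`, contained in `R`, such that for almost
every `x`, the connected component of `x` in `T` is a tree whose vertex set is the `R`-class
of `x`. -/
def IsTreeable {X : Type u} [MeasurableSpace X] (R : Setoid X) (μ : Measure X) : Prop :=
  ∃ T : SimpleGraph X,
    MeasurableSet {p : X × X | T.Adj p.1 p.2} ∧
    (∀ x y : X, T.Adj x y → R x y) ∧
    ∀ᵐ x ∂μ, (T.connectedComponentMk x).toSimpleGraph.IsTree ∧
      (T.connectedComponentMk x).supp = {y : X | R y x}

/-! ### Groupoids, in terms of their arrows -/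

/-- A groupoid with set of arrows `G` and set of units `X` (embedded in `G` by `unit`). The product
`g h` is defined if and only if `src g = tgt h`. -/
structure ArrowGroupoid (X G : Type u) where
  src : G → X
  tgt : G → X
  unit : X → G
  inv : G → G
  mul : (g h : G) → src g = tgt h → G
  src_unit : ∀ x, src (unit x) = x
  tgt_unit : ∀ x, tgt (unit x) = x
  src_inv : ∀ g, src (inv g) = tgt g
  tgt_inv : ∀ g, tgt (inv g) = src g
  src_mul : ∀ g h e, src (mul g h e) = src h
  tgt_mul : ∀ g h e, tgt (mul g h e) = tgt g
  mul_assoc : ∀ g h k (e : src g = tgt h) (e' : src h = tgt k),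
    mul (mul g h e) k ((src_mul g h e).trans e') = mul g (mul h k e') (e.trans (tgt_mul h k e').symm)
  unit_mul : ∀ g, mul (unit (tgt g)) g (src_unit _) = g
  mul_unit : ∀ g, mul g (unit (src g)) (tgt_unit _).symm = g
  inv_mul : ∀ g, mul (inv g) g (src_inv g) = unit (src g)
  mul_inv : ∀ g, mul g (inv g) (tgt_inv g).symm = unit (tgt g)

namespace ArrowGroupoid

variable {X G : Type u}

/-- The measure `μ_s` on `G` given by integrating the counting measure over the fibers of the
source map: `μ_s E = ∫ #(E ∩ src⁻¹ {x}) dμ(x)`. -/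
noncomputable def srcMeasure [MeasurableSpace X] [MeasurableSpace G] (𝒢 : ArrowGroupoid X G)
    (μ : Measure X) : Measure G :=
  μ.bind fun x => Measure.count.restrict (𝒢.src ⁻¹' {x})

/-- The measure `μ_t` on `G` given by integrating the counting measure over the fibers of the
target map. -/
noncomputable def tgtMeasure [MeasurableSpace X] [MeasurableSpace G] (𝒢 : ArrowGroupoid X G)
    (μ : Measure X) : Measure G :=
  μ.bind fun x => Measure.count.restrict (𝒢.tgt ⁻¹' {x})

/-- The isotropy group `Γ_x` of arrows with source and target `x`. -/
@[ext]
structure Isotropy (𝒢 : ArrowGroupoid X G) (x : X) : Type u where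
  val : G
  src_val : 𝒢.src val = x
  tgt_val : 𝒢.tgt val = x

theorem unit_mul_of_tgt (𝒢 : ArrowGroupoid X G) (x : X) (g : G) (hg : 𝒢.tgt g = x) :
    𝒢.mul (𝒢.unit x) g ((𝒢.src_unit x).trans hg.symm) = g := by
  subst hg; exact 𝒢.unit_mul g

theorem inv_mul_of_src (𝒢 : ArrowGroupoid X G) (x : X) (g : G) (hg : 𝒢.src g = x) :
    𝒢.mul (𝒢.inv g) g (𝒢.src_inv g) = 𝒢.unit x := by
  subst hg; exact 𝒢.inv_mul g

theorem mul_unit_of_src (𝒢 : ArrowGroupoid X G) (x : X) (g : G) (hg : 𝒢.src g = x) :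
    𝒢.mul g (𝒢.unit x) (hg.trans (𝒢.tgt_unit x).symm) = g := by
  subst hg; exact 𝒢.mul_unit g

instance (𝒢 : ArrowGroupoid X G) (x : X) : Group (𝒢.Isotropy x) where
  mul g h := ⟨𝒢.mul g.val h.val (g.src_val.trans h.tgt_val.symm),
    (𝒢.src_mul _ _ _).trans h.src_val, (𝒢.tgt_mul _ _ _).trans g.tgt_val⟩
  one := ⟨𝒢.unit x, 𝒢.src_unit x, 𝒢.tgt_unit x⟩
  inv g := ⟨𝒢.inv g.val, (𝒢.src_inv _).trans g.tgt_val, (𝒢.tgt_inv _).trans g.src_val⟩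
  mul_assoc g h k := Isotropy.ext (𝒢.mul_assoc g.val h.val k.val _ _)
  one_mul g := Isotropy.ext (𝒢.unit_mul_of_tgt x g.val g.tgt_val)
  mul_one g := Isotropy.ext (𝒢.mul_unit_of_src x g.val g.src_val)
  inv_mul_cancel g := Isotropy.ext (𝒢.inv_mul_of_src x g.val g.src_val)

/-- The restriction of a groupoid to a set `A` of units: the arrows with source and target
in `A`. -/
def restrict (𝒢 : ArrowGroupoid X G) (A : Set X) :
    ArrowGroupoid A {g : G // 𝒢.src g ∈ A ∧ 𝒢.tgt g ∈ A} where
  src g := ⟨𝒢.src g.1, g.2.1⟩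
  tgt g := ⟨𝒢.tgt g.1, g.2.2⟩
  unit x := ⟨𝒢.unit x.1, by rw [𝒢.src_unit]; exact x.2, by rw [𝒢.tgt_unit]; exact x.2⟩
  inv g := ⟨𝒢.inv g.1, by rw [𝒢.src_inv]; exact g.2.2, by rw [𝒢.tgt_inv]; exact g.2.1⟩
  mul g h e := ⟨𝒢.mul g.1 h.1 (congrArg Subtype.val e),
    by rw [𝒢.src_mul]; exact h.2.1, by rw [𝒢.tgt_mul]; exact g.2.2⟩
  src_unit x := Subtype.ext (𝒢.src_unit _)
  tgt_unit x := Subtype.ext (𝒢.tgt_unit _)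
  src_inv g := Subtype.ext (𝒢.src_inv _)
  tgt_inv g := Subtype.ext (𝒢.tgt_inv _)
  src_mul g h e := Subtype.ext (𝒢.src_mul _ _ _)
  tgt_mul g h e := Subtype.ext (𝒢.tgt_mul _ _ _)
  mul_assoc g h k e e' := Subtype.ext (𝒢.mul_assoc _ _ _ _ _)
  unit_mul g := Subtype.ext (𝒢.unit_mul _)
  mul_unit g := Subtype.ext (𝒢.mul_unit _)
  inv_mul g := Subtype.ext (𝒢.inv_mul _)
  mul_inv g := Subtype.ext (𝒢.mul_inv _)

/-! ### Actions on the field of isotropy groups and semidirect products -/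

/-- A (Borel) action of the equivalence relation `R` on the field of isotropy groups
`(Γ_x)` of a groupoid: a Borel family of group isomorphisms `δ_(x,y) : Γ_y → Γ_x` for `(x,y) ∈ R`
such that `δ_(x,y) ∘ δ_(y,z) = δ_(x,z)`. -/
structure IsotropyAction [MeasurableSpace X] [MeasurableSpace G] (𝒢 : ArrowGroupoid X G)
    (R : Setoid X) where
  map : ∀ x y : X, R x y → (𝒢.Isotropy y ≃* 𝒢.Isotropy x)
  map_map : ∀ (x y z : X) (hxy : R x y) (hyz : R y z) (g : 𝒢.Isotropy z),
    map x y hxy (map y z hyz g) = map x z (R.trans hxy hyz) g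
  measurable_map : Measurable fun
    p : {p : (X × X) × G // R p.1.1 p.1.2 ∧ 𝒢.src p.2 = p.1.2 ∧ 𝒢.tgt p.2 = p.1.2} =>
      (map p.1.1.1 p.1.1.2 p.2.1 ⟨p.1.2, p.2.2.1, p.2.2.2⟩).val

theorem IsotropyAction.map_self [MeasurableSpace X] [MeasurableSpace G] {𝒢 : ArrowGroupoid X G}
    {R : Setoid X} (δ : 𝒢.IsotropyAction R) (x : X) (h : R x x) (g : 𝒢.Isotropy x) :
    δ.map x x h g = g :=
  (δ.map x x h).injective (δ.map_map x x x h h g)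

theorem IsotropyAction.mul_assoc_aux [MeasurableSpace X] [MeasurableSpace G]
    {𝒢 : ArrowGroupoid X G} {R : Setoid X} (δ : 𝒢.IsotropyAction R) (x y z : X) (hxy : R x y)
    (hyz : R y z) (g : 𝒢.Isotropy x) (h : 𝒢.Isotropy y) (k : 𝒢.Isotropy z) :
    (g * δ.map x y hxy h) * δ.map x z (R.trans hxy hyz) k =
      g * δ.map x y hxy (h * δ.map y z hyz k) := by
  rw [map_mul, δ.map_map, _root_.mul_assoc]

/-- The arrows of the semidirect product of `R` acting on the field `(Γ_x)` of isotropy groups: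
the elements `((x, y), g)` with `(x, y) ∈ R` and `g ∈ Γ_x`. They carry the Borel structure inherited
from `(X × X) × G`. -/
abbrev SemidirectArrow (𝒢 : ArrowGroupoid X G) (R : Setoid X) : Type u :=
  {p : (X × X) × G // R p.1.1 p.1.2 ∧ 𝒢.src p.2 = p.1.1 ∧ 𝒢.tgt p.2 = p.1.1}

/-- The `Γ_x`-coordinate `g` of the arrow `((x, y), g)`. -/
def SemidirectArrow.iso {𝒢 : ArrowGroupoid X G} {R : Setoid X} (p : 𝒢.SemidirectArrow R) :
    𝒢.Isotropy p.1.1.1 := ⟨p.1.2, p.2.2.1, p.2.2.2⟩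

/-- The arrow `((x, y), g)`. -/
def SemidirectArrow.mk {𝒢 : ArrowGroupoid X G} {R : Setoid X} (x y : X) (h : R x y)
    (g : 𝒢.Isotropy x) : 𝒢.SemidirectArrow R := ⟨((x, y), g.val), h, g.src_val, g.tgt_val⟩

theorem SemidirectArrow.mk_congr {𝒢 : ArrowGroupoid X G} {R : Setoid X} {x y y' : X} {h : R x y}
    {h' : R x y'} {g g' : 𝒢.Isotropy x} (hy : y = y') (hg : g = g') :
    SemidirectArrow.mk x y h g = SemidirectArrow.mk x y' h' g' := by
  subst hy hg; rfl

/-- The semidirect product groupoid of `R` acting on the field `(Γ_x)` of isotropy groups by `δ`.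
The arrow `((x, y), g)` has source `y` and target `x`, and
`((x, y), g) ((y, z), h) = ((x, z), g δ_(x,y)(h))`. -/
def semidirectProduct [MeasurableSpace X] [MeasurableSpace G] (𝒢 : ArrowGroupoid X G)
    (R : Setoid X) (δ : 𝒢.IsotropyAction R) : ArrowGroupoid X (𝒢.SemidirectArrow R) where
  src p := p.1.1.2
  tgt p := p.1.1.1
  unit x := .mk x x (R.refl x) 1
  inv p := .mk p.1.1.2 p.1.1.1 (R.symm p.2.1) (δ.map _ _ (R.symm p.2.1) p.iso⁻¹)
  mul p q e :=
    have h : R p.1.1.1 q.1.1.1 := e ▸ p.2.1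
    .mk p.1.1.1 q.1.1.2 (R.trans h q.2.1) (p.iso * δ.map p.1.1.1 q.1.1.1 h q.iso)
  src_unit x := rfl
  tgt_unit x := rfl
  src_inv p := rfl
  tgt_inv p := rfl
  src_mul p q e := rfl
  tgt_mul p q e := rfl
  mul_assoc := by
    rintro ⟨⟨⟨x, y⟩, g⟩, hxy, hg⟩ ⟨⟨⟨y', z⟩, h⟩, hyz, hh⟩ ⟨⟨⟨z', w⟩, k⟩, hzw, hk⟩ e e'
    obtain rfl : y = y' := e
    obtain rfl : z = z' := e'
    exact SemidirectArrow.mk_congr rfl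
      (δ.mul_assoc_aux x y z hxy hyz ⟨g, hg.1, hg.2⟩ ⟨h, hh.1, hh.2⟩ ⟨k, hk.1, hk.2⟩)
  unit_mul p := SemidirectArrow.mk_congr (h' := p.2.1) (g' := p.iso) rfl
    ((one_mul (δ.map _ _ _ p.iso)).trans (δ.map_self _ _ _))
  mul_unit p := SemidirectArrow.mk_congr (h' := p.2.1) (g' := p.iso) rfl
    ((congrArg (p.iso * ·) (map_one (δ.map _ _ p.2.1))).trans (mul_one p.iso))
  inv_mul p := SemidirectArrow.mk_congr rfl
    ((map_mul (δ.map _ _ (R.symm p.2.1)) p.iso⁻¹ p.iso).symm.trans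
      ((congrArg _ (inv_mul_cancel p.iso)).trans (map_one _)))
  mul_inv p := SemidirectArrow.mk_congr rfl
    ((congrArg (p.iso * ·) ((δ.map_map _ _ _ p.2.1 (R.symm p.2.1) p.iso⁻¹).trans
      (δ.map_self _ _ _))).trans (mul_inv_cancel p.iso))

/-- A Borel isomorphism between two groupoids with the same unit space, that is the identity on
units. -/
structure BorelIso {G' : Type u} [MeasurableSpace G] [MeasurableSpace G']
    (𝒢 : ArrowGroupoid X G) (𝒢' : ArrowGroupoid X G') where
  toEquiv : G ≃ᵐ G'
  src_map : ∀ g, 𝒢'.src (toEquiv g) = 𝒢.src g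
  tgt_map : ∀ g, 𝒢'.tgt (toEquiv g) = 𝒢.tgt g
  map_mul : ∀ (g h : G) (e : 𝒢.src g = 𝒢.tgt h),
    toEquiv (𝒢.mul g h e) =
      𝒢'.mul (toEquiv g) (toEquiv h) ((src_map g).trans (e.trans (tgt_map h).symm))

/-- `𝒢` is everywhere a semidirect product of `R` acting on the field of isotropy groups of `𝒢`:
for some action of `R`, there is a Borel isomorphism of the semidirect product onto `𝒢` that is the
identity on units and on the isotropy groups. -/
def IsStrictSemidirectProduct [MeasurableSpace X] [MeasurableSpace G] (𝒢 : ArrowGroupoid X G)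
    (R : Setoid X) : Prop :=
  ∃ (δ : 𝒢.IsotropyAction R) (Φ : BorelIso (𝒢.semidirectProduct R δ) 𝒢),
    ∀ (x : X) (g : 𝒢.Isotropy x), Φ.toEquiv (SemidirectArrow.mk x x (R.refl x) g) = g.val

/-- `𝒢` is a semidirect product of `R` acting on the field of isotropy groups of `𝒢`, up to measure
zero: this holds strictly after restriction to some `R`-invariant Borel set of full measure. -/
def IsSemidirectProduct [MeasurableSpace X] [MeasurableSpace G] (𝒢 : ArrowGroupoid X G)
    (R : Setoid X) (μ : Measure X) : Prop :=
  ∃ A : Set X, MeasurableSet A ∧ μ Aᶜ = 0 ∧ (∀ x y : X, R x y → (x ∈ A ↔ y ∈ A)) ∧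
    (𝒢.restrict A).IsStrictSemidirectProduct (R.comap ((↑) : A → X))

end ArrowGroupoid

/-- A discrete measured groupoid with set of arrows `G` and unit space `(X, μ)`. -/
structure DiscreteMeasuredGroupoid (X G : Type u) [MeasurableSpace X] [MeasurableSpace G]
    (μ : Measure X) extends ArrowGroupoid X G where
  standardBorel : StandardBorelSpace G
  measurableEmbedding_unit : MeasurableEmbedding unit
  measurable_src : Measurable src
  measurable_tgt : Measurable tgt
  countable_src_fiber : ∀ x, (src ⁻¹' {x}).Countable
  countable_tgt_fiber : ∀ x, (tgt ⁻¹' {x}).Countable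
  measurable_mul : Measurable fun p : {p : G × G // src p.1 = tgt p.2} => mul p.1.1 p.1.2 p.2
  measurable_inv : Measurable inv
  srcMeasure_absolutelyContinuous :
    toArrowGroupoid.srcMeasure μ ≪ toArrowGroupoid.tgtMeasure μ
  tgtMeasure_absolutelyContinuous :
    toArrowGroupoid.tgtMeasure μ ≪ toArrowGroupoid.srcMeasure μ

/-! Both directions pass through Borel homomorphic sections of `𝒢` over `R`. If `θ` assigns to each
`(x, y)` in `R` an arrow from `y` to `x`, multiplicatively, then conjugation by `θ` is an action on
the isotropy groups and `((x, y), g) ↦ g θ(x, y)` is an isomorphism onto `𝒢`. Conversely, a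
semidirect product has the section `((x, y), 1)`.

Treeable implies split: by Lusin–Novikov an arrow can be chosen in a Borel way over each oriented
edge of the treeing, with the inverse over the reversed edge. A tree imposes no relations, so
products along walks depend only on the endpoints and define `θ`. The set of these products is
analytic, and this makes `θ` Borel (`isStrictSemidirectProduct_of_isAcyclic`).

Split implies treeable: by Feldman–Moore, `R` is the orbit relation of a Borel action of the free
group `F` on countably many generators. A splitting of the action groupoid is a cocycle `c : R → F`
with `c(x, y) y = x`. For fixed `y`, the map `x ↦ c(x, y)` embeds the class of `y` in `F`, and a
change of `y` translates the image on the right. The Cayley tree of left multiplications is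
invariant under right translations. Contracting the fibers of a right-equivariant nearest point
projection onto the image, which are connected, leaves a tree on the image, and this tree descends
to the class (`contractedGraph_isAcyclic`, `isTreeable_of_cocycle`).

Nonsingularity makes the action groupoid a measured groupoid, and allows null sets to be enlarged to
invariant ones. -/

/-! ### The Lusin–Novikov theorem, by a Cantor scheme. -/

section LusinNovikov

open Set Filter Topology

variable {G Y : Type*}

/-- A set is `f`-small if it is contained in a countable union of Borel sets on which `f` is
injective. -/
def IsFiberSmall [MeasurableSpace G] (f : G → Y) (S : Set G) : Prop :=
  ∃ B : ℕ → Set G, (∀ n, MeasurableSet (B n) ∧ InjOn f (B n)) ∧ S ⊆ ⋃ n, B n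

theorem isFiberSmall_empty [MeasurableSpace G] (f : G → Y) : IsFiberSmall f ∅ :=
  ⟨fun _ => ∅, fun _ => ⟨.empty, injOn_empty f⟩, empty_subset _⟩

theorem IsFiberSmall.exists_measurableSet [MeasurableSpace G] {f : G → Y} {S : Set G}
    (hS : IsFiberSmall f S) : ∃ S', MeasurableSet S' ∧ S ⊆ S' ∧ IsFiberSmall f S' := by
  obtain ⟨B, hB, hSB⟩ := hS
  exact ⟨⋃ n, B n, .iUnion fun n => (hB n).1, hSB, B, hB, Subset.rfl⟩

theorem isFiberSmall_iUnion [MeasurableSpace G] {f : G → Y} {ι : Type*} [Countable ι]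
    {S : ι → Set G} (h : ∀ i, IsFiberSmall f (S i)) : IsFiberSmall f (⋃ i, S i) := by
  rcases isEmpty_or_nonempty ι with hι | hι
  · rw [iUnion_of_empty]; exact isFiberSmall_empty f
  choose B hB hSB using h
  obtain ⟨e, he⟩ := exists_surjective_nat (ι × ℕ)
  refine ⟨fun n => B (e n).1 (e n).2, fun n => hB _ _, iUnion_subset fun i x hx => ?_⟩
  obtain ⟨k, hk⟩ := mem_iUnion.1 (hSB i hx)
  obtain ⟨n, hn⟩ := he (i, k)
  exact mem_iUnion.2 ⟨n, by rw [hn]; exact hk⟩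

theorem IsFiberSmall.union [MeasurableSpace G] {f : G → Y} {S T : Set G}
    (hS : IsFiberSmall f S) (hT : IsFiberSmall f T) : IsFiberSmall f (S ∪ T) := by
  rw [union_eq_iUnion]
  exact isFiberSmall_iUnion fun b => by cases b <;> assumption

/-- An analytic set on which `f` is injective is contained in a Borel set on which `f` is
injective. -/
theorem AnalyticSet.exists_measurableSet_injOn [TopologicalSpace G] [PolishSpace G]
    [MeasurableSpace G] [BorelSpace G] [TopologicalSpace Y] [T2Space Y]
    {f : G → Y} (hf : Continuous f) {D : Set G} (hD : AnalyticSet D) (hinj : InjOn f D) :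
    ∃ B, MeasurableSet B ∧ D ⊆ B ∧ InjOn f B := by
  let K : Set (G × G) := {p | f p.1 = f p.2 ∧ p.1 ≠ p.2}
  have hK : MeasurableSet K :=
    (isClosed_eq (hf.comp continuous_fst) (hf.comp continuous_snd)).measurableSet.inter
      (isClosed_diagonal (X := G)).measurableSet.compl
  -- The set in question consists of the points with a distinct `f`-partner in `C`. Separating `D`
  -- from the partners of `D` gives `C`; partnership is symmetric, so `D` also misses the partners
  -- of `C`, and a second separation gives `E`. No point of `E` then has a partner in `C`.
  have key : ∀ C : Set G, AnalyticSet C → AnalyticSet (Prod.snd '' (Prod.fst ⁻¹' C ∩ K)) := by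
    intro C hC
    refine AnalyticSet.image_of_continuous ?_ continuous_snd
    have h1 : AnalyticSet (Prod.fst ⁻¹' C : Set (G × G)) := hC.preimage continuous_fst
    have h2 : AnalyticSet K := hK.analyticSet
    rw [inter_eq_iInter]
    exact AnalyticSet.iInter fun b => by cases b <;> assumption
  obtain ⟨C, hDC, hC', hCm⟩ := hD.measurablySeparable (key D hD) (by
    rw [Set.disjoint_left]
    rintro b hb ⟨⟨a, b'⟩, ⟨ha, h1, h2⟩, rfl⟩
    exact h2 (hinj ha hb h1))
  obtain ⟨E, hDE, hE', hEm⟩ := hD.measurablySeparable (key C hCm.analyticSet) (by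
    rw [Set.disjoint_left]
    rintro b hb ⟨⟨a, b'⟩, ⟨ha, h1, h2⟩, rfl⟩
    exact Set.disjoint_left.1 hC' ⟨(b', a), ⟨hb, h1.symm, h2.symm⟩, rfl⟩ ha)
  refine ⟨C ∩ E, hCm.inter hEm, subset_inter hDC hDE, ?_⟩
  rintro a ⟨haC, -⟩ b ⟨-, hbE⟩ hab
  by_contra hne
  exact Set.disjoint_left.1 hE' ⟨(a, b), ⟨haC, hab, hne⟩, rfl⟩ hbE

/-- A family of sets is jointly `f`-large if, after removal of any `f`-small set, some fiber of `f`
meets all its members. -/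
def JointlyLarge [MeasurableSpace G] (f : G → Y) {K : Type*} (A : K → Set G) : Prop :=
  ∀ S, IsFiberSmall f S → ∃ y, ∀ k, ∃ g ∈ A k \ S, f g = y

/-- Two members of a jointly large family of open sets can be replaced by small open subsets of the
first of them with disjoint closures. -/
theorem JointlyLarge.split [MetricSpace G] [CompleteSpace G] [SecondCountableTopology G]
    [MeasurableSpace G] [BorelSpace G] [TopologicalSpace Y] [T2Space Y]
    {f : G → Y} (hf : Continuous f) {K : Type*} [Finite K] [DecidableEq K] {A : K → Set G}
    (hA : JointlyLarge f A) (hAo : ∀ k, IsOpen (A k)) (k₀ k₁ : K)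
    {ε : ℝ} (hε : 0 < ε) :
    ∃ U V : Set G, IsOpen U ∧ IsOpen V ∧ U ⊆ A k₀ ∧ V ⊆ A k₀ ∧ (∀ x ∈ U, ∀ y ∈ U, dist x y ≤ ε) ∧
      (∀ x ∈ V, ∀ y ∈ V, dist x y ≤ ε) ∧ Disjoint (closure U) (closure V) ∧
      JointlyLarge f (Function.update (Function.update A k₀ U) k₁ V) := by
  by_contra! hcon
  obtain ⟨b, hbc, -, hb⟩ := TopologicalSpace.exists_countable_basis G
  have : Countable b := hbc.to_subtype
  let P : Type _ := {p : b × b // (p.1 : Set G) ⊆ A k₀ ∧ (p.2 : Set G) ⊆ A k₀ ∧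
    (∀ x ∈ (p.1 : Set G), ∀ y ∈ (p.1 : Set G), dist x y ≤ ε) ∧
    (∀ x ∈ (p.2 : Set G), ∀ y ∈ (p.2 : Set G), dist x y ≤ ε) ∧
    Disjoint (closure (p.1 : Set G)) (closure (p.2 : Set G))}
  have hP : ∀ p : P, ∃ S, IsFiberSmall f S ∧ ∀ y, ∃ k,
      ∀ g ∈ (Function.update (Function.update A k₀ p.1.1) k₁ p.1.2) k \ S, f g ≠ y := by
    intro p
    have := hcon p.1.1 p.1.2 (hb.isOpen p.1.1.2) (hb.isOpen p.1.2.2) p.2.1 p.2.2.1 p.2.2.2.1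
      p.2.2.2.2.1 p.2.2.2.2.2
    unfold JointlyLarge at this
    push Not at this
    exact this
  -- There are only countably many pairs of basic open sets, so the small sets witnessing their
  -- failure have a small union. Outside it, a fiber meeting all the `A k` cannot have two points in
  -- `A k₀`, as these would be separated by such a pair.
  choose S hS hSk using hP
  obtain ⟨S', hS'm, hSS', hS'⟩ := (isFiberSmall_iUnion hS).exists_measurableSet
  let D : Set G := ⋂ k, f ⁻¹' (f '' (A k \ S'))
  have han : ∀ k, AnalyticSet (A k \ S') := fun k =>
    ((hAo k).measurableSet.diff hS'm).analyticSet
  have hDan : AnalyticSet (A k₀ \ S' ∩ D) := by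
    have : Nonempty K := ⟨k₀⟩
    have h1 : AnalyticSet D := AnalyticSet.iInter fun k =>
      ((han k).image_of_continuous hf).preimage hf
    have h2 := han k₀
    rw [inter_eq_iInter]
    exact AnalyticSet.iInter fun b => by cases b <;> assumption
  have hinj : InjOn f (A k₀ \ S' ∩ D) := by
    rintro g ⟨hg, hgD⟩ g' ⟨hg', -⟩ hgg'
    by_contra hne
    obtain ⟨u, hu, huo, v, hv, hvo, huv⟩ := exists_open_nhds_disjoint_closure hne
    have hnb : ∀ x ∈ A k₀, ∀ w, IsOpen w → x ∈ w → ∃ U ∈ b, x ∈ U ∧ U ⊆ A k₀ ∧ U ⊆ w ∧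
        ∀ y ∈ U, ∀ z ∈ U, dist y z ≤ ε := by
      intro x hx w hw hxw
      obtain ⟨U, hU, hxU, hUs⟩ := hb.exists_subset_of_mem_open
        (show x ∈ A k₀ ∩ w ∩ Metric.ball x (ε / 2) from ⟨⟨hx, hxw⟩, Metric.mem_ball_self (by positivity)⟩)
        (((hAo k₀).inter hw).inter Metric.isOpen_ball)
      refine ⟨U, hU, hxU, fun y hy => (hUs hy).1.1, fun y hy => (hUs hy).1.2, fun y hy z hz => ?_⟩
      have h1 := (hUs hy).2
      have h2 := (hUs hz).2
      rw [Metric.mem_ball] at h1 h2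
      linarith [dist_triangle_right y z x]
    obtain ⟨U, hUb, hgU, hUA, hUu, hUd⟩ := hnb g hg.1 u huo hu
    obtain ⟨V, hVb, hgV, hVA, hVv, hVd⟩ := hnb g' hg'.1 v hvo hv
    let p : P := ⟨(⟨U, hUb⟩, ⟨V, hVb⟩), hUA, hVA, hUd, hVd,
      huv.mono (closure_mono hUu) (closure_mono hVv)⟩
    obtain ⟨k, hk'⟩ := hSk p (f g)
    have hsub : S p ⊆ S' := (subset_iUnion S p).trans hSS'
    rcases eq_or_ne k k₁ with rfl | h1
    · rw [Function.update_self] at hk'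
      exact hk' g' ⟨hgV, fun h => hg'.2 (hsub h)⟩ hgg'.symm
    rcases eq_or_ne k k₀ with rfl | h0
    · rw [Function.update_of_ne h1, Function.update_self] at hk'
      exact hk' g ⟨hgU, fun h => hg.2 (hsub h)⟩ rfl
    · rw [Function.update_of_ne h1, Function.update_of_ne h0] at hk'
      obtain ⟨g'', hg'', h''⟩ := mem_iInter.1 hgD k
      exact hk' g'' ⟨hg''.1, fun h => hg''.2 (hsub h)⟩ h''
  -- Enlarging the removed small set by the Borel hull `B` of the injective part leaves no fiber
  -- that meets every `A k`, contrary to `hA`.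
  obtain ⟨B, hBm, hDB, hB⟩ := AnalyticSet.exists_measurableSet_injOn hf hDan hinj
  obtain ⟨y, hy⟩ := hA (S' ∪ B) (hS'.union ⟨fun _ => B, fun _ => ⟨hBm, hB⟩, subset_iUnion (fun _ : ℕ => B) 0⟩)
  obtain ⟨g, ⟨hgA, hgn⟩, rfl⟩ := hy k₀
  refine hgn (Or.inr (hDB ⟨⟨hgA, fun h => hgn (Or.inl h)⟩, mem_iInter.2 fun k => ?_⟩))
  obtain ⟨g', ⟨hgA', hgn'⟩, h'⟩ := hy k
  exact ⟨g', ⟨hgA', fun h => hgn' (Or.inl h)⟩, h'⟩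

/-- Two identical copies of each member are still jointly large, since one point serves for both.
The pairs of copies are then separated one index at a time, the indices outside `s` keeping their
identical copies. -/
theorem JointlyLarge.split_all [MetricSpace G] [CompleteSpace G] [SecondCountableTopology G]
    [MeasurableSpace G] [BorelSpace G] [TopologicalSpace Y] [T2Space Y]
    {f : G → Y} (hf : Continuous f) {I : Type*} [Finite I] {A : I → Set G}
    (hA : JointlyLarge f A) (hAo : ∀ k, IsOpen (A k)) {ε : ℝ} (hε : 0 < ε) :
    ∃ B : I × Bool → Set G, (∀ k, IsOpen (B k) ∧ B k ⊆ A k.1 ∧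
        (∀ x ∈ B k, ∀ y ∈ B k, dist x y ≤ ε)) ∧
      (∀ i, Disjoint (closure (B (i, false))) (closure (B (i, true)))) ∧ JointlyLarge f B := by
  classical
  have := Fintype.ofFinite I
  suffices h : ∀ s : Finset I, ∃ B : I × Bool → Set G, (∀ k, IsOpen (B k) ∧ B k ⊆ A k.1 ∧
        (k.1 ∈ s → ∀ x ∈ B k, ∀ y ∈ B k, dist x y ≤ ε)) ∧
      (∀ i ∈ s, Disjoint (closure (B (i, false))) (closure (B (i, true)))) ∧
      (∀ i ∉ s, ∀ b, B (i, b) = A i) ∧ JointlyLarge f B by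
    obtain ⟨B, h1, h2, -, h3⟩ := h Finset.univ
    exact ⟨B, fun k => ⟨(h1 k).1, (h1 k).2.1, (h1 k).2.2 (Finset.mem_univ _)⟩,
      fun i => h2 i (Finset.mem_univ _), h3⟩
  intro s
  induction s using Finset.induction_on with
  | empty =>
    refine ⟨fun k => A k.1, fun k => ⟨hAo _, Subset.rfl, by simp⟩, by simp, fun _ _ _ => rfl, ?_⟩
    intro S hS
    obtain ⟨y, hy⟩ := hA S hS
    exact ⟨y, fun k => hy k.1⟩
  | insert i s his ih =>
    obtain ⟨B, h1, h2, h3, h4⟩ := ih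
    obtain ⟨U, V, hU, hV, hUA, hVA, hUd, hVd, hUV, hJ⟩ := h4.split hf (fun k => (h1 k).1)
      (i, false) (i, true) hε
    rw [h3 i his] at hUA hVA
    have e0 : Function.update (Function.update B (i, false) U) (i, true) V (i, false) = U := by
      rw [Function.update_of_ne (by simp), Function.update_self]
    have e1 : Function.update (Function.update B (i, false) U) (i, true) V (i, true) = V :=
      Function.update_self _ _ _
    have e : ∀ j ≠ i, ∀ b,
        Function.update (Function.update B (i, false) U) (i, true) V (j, b) = B (j, b) := by
      intro j hj b
      rw [Function.update_of_ne (by simp [hj]), Function.update_of_ne (by simp [hj])]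
    refine ⟨_, ?_, ?_, ?_, hJ⟩
    · rintro ⟨j, b⟩
      rcases eq_or_ne j i with rfl | hj
      · cases b
        · rw [e0]; exact ⟨hU, hUA, fun _ => hUd⟩
        · rw [e1]; exact ⟨hV, hVA, fun _ => hVd⟩
      · rw [e j hj]
        exact ⟨(h1 _).1, (h1 _).2.1, fun h => (h1 (j, b)).2.2 (Finset.mem_of_mem_insert_of_ne h hj)⟩
    · intro j hj'
      rcases eq_or_ne j i with rfl | hj
      · rw [e0, e1]; exact hUV
      · rw [e j hj, e j hj]
        exact h2 j (Finset.mem_of_mem_insert_of_ne hj' hj)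
    · intro j hj' b
      rw [Finset.mem_insert, not_or] at hj'
      rw [e j hj'.1, h3 j hj'.2]

/-- If the whole space is not small, then some fiber contains a copy of the Cantor space. -/
theorem isFiberSmall_univ_of_continuous [MetricSpace G] [CompleteSpace G]
    [SecondCountableTopology G] [MeasurableSpace G] [BorelSpace G] [TopologicalSpace Y] [T2Space Y]
    {f : G → Y} (hf : Continuous f) (hc : ∀ y, (f ⁻¹' {y}).Countable) :
    IsFiberSmall f univ := by
  by_contra hbig
  -- Stage `n` of the Cantor scheme: `2 ^ n` open sets that are jointly large.
  let St (n : ℕ) : Type _ := {A : (Fin n → Bool) → Set G // (∀ k, IsOpen (A k)) ∧ JointlyLarge f A}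
  have hstep : ∀ n (A : St n), ∃ B : St (n + 1),
      (∀ u, B.1 u ⊆ A.1 (Fin.init u) ∧ ∀ x ∈ B.1 u, ∀ y ∈ B.1 u, dist x y ≤ (1 / 2 : ℝ) ^ n) ∧
      ∀ u v, Fin.init u = (Fin.init v : Fin n → Bool) → u (Fin.last n) ≠ v (Fin.last n) →
        Disjoint (closure (B.1 u)) (closure (B.1 v)) := by
    intro n A
    obtain ⟨B, h1, h2, h3⟩ := A.2.2.split_all hf A.2.1 (ε := (1 / 2 : ℝ) ^ n) (by positivity)
    refine ⟨⟨fun u => B (Fin.init u, u (Fin.last n)), fun k => (h1 _).1, fun S hS => ?_⟩,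
      fun u => (h1 _).2, fun u v huv hne => ?_⟩
    · obtain ⟨y, hy⟩ := h3 S hS
      exact ⟨y, fun k => hy _⟩
    · simp only [huv]
      cases hu : u (Fin.last n) <;> cases hv : v (Fin.last n)
      · simp [hu, hv] at hne
      · exact h2 _
      · exact (h2 _).symm
      · simp [hu, hv] at hne
  choose step hs1 hs2 using hstep
  have h0 : JointlyLarge f (fun _ : Fin 0 → Bool => (univ : Set G)) := by
    intro S hS
    by_contra! hcon
    obtain ⟨B, hB, hSB⟩ := hS
    refine hbig ⟨B, hB, fun x _ => hSB ?_⟩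
    by_contra hx
    obtain ⟨_, h⟩ := hcon (f x)
    exact h x ⟨trivial, hx⟩ rfl
  let A (n : ℕ) : St n := Nat.rec ⟨fun _ => univ, fun _ => isOpen_univ, h0⟩ (fun n s => step n s) n
  let r (x : ℕ → Bool) (n : ℕ) : Fin n → Bool := fun i => x i
  have hsub : ∀ x n, (A (n + 1)).1 (r x (n + 1)) ⊆ (A n).1 (r x n) := fun x n =>
    (hs1 n (A n) (r x (n + 1))).1
  have hanti : ∀ x, Antitone fun n => (A n).1 (r x n) := fun x => antitone_nat_of_succ_le (hsub x)
  have hex : ∀ n, ∃ y, ∀ k, ∃ g ∈ (A n).1 k, f g = y := by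
    intro n
    obtain ⟨y, hy⟩ := (A n).2.2 ∅ (isFiberSmall_empty f)
    exact ⟨y, fun k => by simpa using hy k⟩
  choose y g hg hgy using hex
  -- The index is shifted because stage `n + 1` has diameter at most `(1 / 2) ^ n`, while stage `0`
  -- is the whole space.
  have hcau : ∀ x, CauchySeq fun n => g (n + 1) (r x (n + 1)) := by
    intro x
    refine cauchySeq_of_le_tendsto_0 (fun n => (1 / 2 : ℝ) ^ n) (fun n m N hn hm => ?_)
      (tendsto_pow_atTop_nhds_zero_of_lt_one (by norm_num) (by norm_num))
    exact (hs1 N (A N) (r x (N + 1))).2 _ (hanti x (Nat.succ_le_succ hn) (hg (n + 1) (r x (n + 1)))) _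
      (hanti x (Nat.succ_le_succ hm) (hg (m + 1) (r x (m + 1))))
  choose φ hφ using fun x => cauchySeq_tendsto_of_complete (hcau x)
  have hφA : ∀ x n, φ x ∈ closure ((A n).1 (r x n)) := by
    intro x n
    refine mem_closure_of_tendsto (hφ x) ?_
    filter_upwards [eventually_ge_atTop n] with m hm
    exact hanti x (hm.trans (Nat.le_succ m)) (hg (m + 1) (r x (m + 1)))
  have hinj : Function.Injective φ := by
    intro x x' hxx'
    by_contra hne
    have hex : ∃ n, x n ≠ x' n := Function.ne_iff.1 hne
    classical
    let n := Nat.find hex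
    have hn : x n ≠ x' n := Nat.find_spec hex
    have hlt : ∀ m < n, x m = x' m := fun m hm => not_not.1 (Nat.find_min hex hm)
    have := hs2 n (A n) (r x (n + 1)) (r x' (n + 1))
      (funext fun i => hlt i i.2) hn
    exact Set.disjoint_left.1 this (hφA x (n + 1)) (hxx' ▸ hφA x' (n + 1))
  -- At each stage the chosen points on all branches lie in one fiber, over `y n`. By continuity, `f
  -- (φ x)` is the limit of `y (n + 1)` for every branch `x`.
  have hconst : ∀ x x', f (φ x) = f (φ x') := by
    intro x x'
    have h1 : ∀ x, Tendsto (fun n => y (n + 1)) atTop (𝓝 (f (φ x))) := fun x => by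
      have := (hf.tendsto (φ x)).comp (hφ x)
      simpa only [Function.comp_def, hgy] using this
    exact tendsto_nhds_unique (h1 x) (h1 x')
  have hcount : (range φ).Countable :=
    (hc (f (φ fun _ => false))).mono (by rintro _ ⟨x, rfl⟩; exact hconst _ _)
  have : Countable (ℕ → Bool) := by
    have := hcount.to_subtype
    exact (rangeFactorization_injective.2 hinj).countable
  obtain ⟨e, he⟩ := exists_surjective_nat (ℕ → Bool)
  obtain ⟨n, hn⟩ := he fun k => !e k k
  simpa using congrFun hn n

/-- The **Lusin–Novikov theorem**: a countable-to-one Borel map is injective on each piece of some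
countable Borel partition. -/
theorem exists_iUnion_injOn_of_countable_fibers [MeasurableSpace G] [StandardBorelSpace G]
    [MeasurableSpace Y] [StandardBorelSpace Y] {f : G → Y} (hf : Measurable f)
    (hc : ∀ y, (f ⁻¹' {y}).Countable) :
    ∃ B : ℕ → Set G, (∀ n, MeasurableSet (B n) ∧ InjOn f (B n)) ∧ ⋃ n, B n = univ := by
  let t := (upgradeStandardBorel G).toTopologicalSpace
  have hG : PolishSpace G := (upgradeStandardBorel G).toPolishSpace
  have hGB : BorelSpace G := (upgradeStandardBorel G).toBorelSpace
  let _ := upgradeStandardBorel Y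
  -- A finer Polish topology makes `f` continuous without changing the Borel sets.
  obtain ⟨t', htt', hfc, hP⟩ := hf.exists_continuous
  have hB : @BorelSpace G t' _ :=
    @BorelSpace.mk _ t' _ (hGB.measurable_eq.trans (borel_eq_borel_of_le hP hG htt').symm)
  clear hGB hG
  clear_value t
  let _ := t'
  let _ := TopologicalSpace.upgradeIsCompletelyMetrizable G
  obtain ⟨B, h1, h2⟩ := isFiberSmall_univ_of_continuous hfc hc
  exact ⟨B, h1, univ_subset_iff.1 h2⟩

end LusinNovikov

/-! ### The Feldman–Moore theorem. -/

section FeldmanMoore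

open Set

/-- The Borel partial injection with graph `E`, extended to an involution that exchanges its
disjoint domain and range. -/
theorem exists_involution_of_graph {X : Type*} [MeasurableSpace X] [StandardBorelSpace X]
    {E : Set (X × X)} (hE : MeasurableSet E) (h₁ : InjOn Prod.fst E) (h₂ : InjOn Prod.snd E)
    (hdisj : Disjoint (Prod.fst '' E) (Prod.snd '' E)) :
    ∃ e : X ≃ᵐ X, (∀ x y, (x, y) ∈ E → e y = x) ∧
      ∀ x, e x = x ∨ (x, e x) ∈ E ∨ (e x, x) ∈ E := by
  classical
  have hun : ∀ x, ∃ y, (y = x ∧ x ∉ Prod.fst '' E ∧ x ∉ Prod.snd '' E) ∨ (x, y) ∈ E ∨ (y, x) ∈ E := by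
    intro x
    by_cases hx : x ∈ Prod.fst '' E
    · obtain ⟨⟨_, y⟩, h, rfl⟩ := hx; exact ⟨y, .inr (.inl h)⟩
    by_cases hx' : x ∈ Prod.snd '' E
    · obtain ⟨⟨y, _⟩, h, rfl⟩ := hx'; exact ⟨y, .inr (.inr h)⟩
    exact ⟨x, .inl ⟨rfl, hx, hx'⟩⟩
  choose ι hι using hun
  have hd : ∀ x y z, (x, y) ∈ E → (z, x) ∉ E := fun x y z h h' =>
    Set.disjoint_left.1 hdisj ⟨_, h, rfl⟩ ⟨_, h', rfl⟩
  have hl : ∀ x y, (x, y) ∈ E → ι x = y := by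
    intro x y h
    rcases hι x with h' | h' | h'
    · exact absurd ⟨_, h, rfl⟩ h'.2.1
    · exact congrArg Prod.snd (h₁ h' h rfl)
    · exact absurd h' (hd _ _ _ h)
  have hr : ∀ x y, (x, y) ∈ E → ι y = x := by
    intro x y h
    rcases hι y with h' | h' | h'
    · exact absurd ⟨_, h, rfl⟩ h'.2.2
    · exact absurd h (hd _ _ _ h')
    · exact congrArg Prod.fst (h₂ h' h rfl)
  have hinv : Function.Involutive ι := by
    intro x
    rcases hι x with h' | h' | h'
    · rw [h'.1, h'.1]
    · exact hr _ _ h'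
    · exact hl _ _ h'
  have hm : Measurable ι := by
    intro S hS
    -- Each piece is a Borel set or an injective Borel image of one, hence Borel.
    have : ι ⁻¹' S = Prod.fst '' (E ∩ Prod.snd ⁻¹' S) ∪ Prod.snd '' (E ∩ Prod.fst ⁻¹' S) ∪
        (S \ (Prod.fst '' E ∪ Prod.snd '' E)) := by
      ext x
      constructor
      · intro hx
        rcases hι x with h' | h' | h'
        · rw [mem_preimage, h'.1] at hx
          exact .inr ⟨hx, fun h => h.elim h'.2.1 h'.2.2⟩
        · exact .inl (.inl ⟨_, ⟨h', hx⟩, rfl⟩)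
        · exact .inl (.inr ⟨_, ⟨h', hx⟩, rfl⟩)
      · rintro ((⟨⟨a, b⟩, ⟨h, hs⟩, rfl⟩ | ⟨⟨a, b⟩, ⟨h, hs⟩, rfl⟩) | ⟨hs, hn⟩)
        · rw [mem_preimage, hl _ _ h]; exact hs
        · rw [mem_preimage, hr _ _ h]; exact hs
        · rcases hι x with h' | h' | h'
          · rwa [mem_preimage, h'.1]
          · exact absurd (.inl ⟨_, h', rfl⟩) hn
          · exact absurd (.inr ⟨_, h', rfl⟩) hn
    have hE₁ : MeasurableSet (E ∩ Prod.snd ⁻¹' S) := hE.inter (measurable_snd hS)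
    have hE₂ : MeasurableSet (E ∩ Prod.fst ⁻¹' S) := hE.inter (measurable_fst hS)
    rw [this]
    exact ((hE₁.image_of_measurable_injOn measurable_fst (h₁.mono inter_subset_left)).union
      (hE₂.image_of_measurable_injOn measurable_snd (h₂.mono inter_subset_left))).union
      (hS.diff ((hE.image_of_measurable_injOn measurable_fst h₁).union
        (hE.image_of_measurable_injOn measurable_snd h₂)))
  exact ⟨⟨hinv.toPerm, hm, hm⟩, hr, fun x => (hι x).imp_left And.left⟩

/-- The **Feldman–Moore theorem**: a Borel equivalence relation with countable classes is
generated by countably many Borel automorphisms. -/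
theorem exists_measurableEquiv_generating {X : Type*} [MeasurableSpace X] [StandardBorelSpace X]
    {R : Setoid X} (hR : MeasurableSet {p : X × X | R p.1 p.2})
    (hc : ∀ x : X, {y : X | R y x}.Countable) :
    ∃ e : ℕ → (X ≃ᵐ X), (∀ n x, R (e n x) x) ∧ ∀ x y, R x y → x ≠ y → ∃ n, e n y = x := by
  have hsb : StandardBorelSpace {p : X × X | R p.1 p.2} := hR.standardBorel
  obtain ⟨B, hB, hBu⟩ := exists_iUnion_injOn_of_countable_fibers
    (f := fun p : {p : X × X | R p.1 p.2} => p.1.1) (measurable_fst.comp measurable_subtype_coe)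
    (fun y => by
      refine MapsTo.countable_of_injOn (f := fun p => p.1.2) (fun p hp => ?_) ?_ (hc y)
      · rw [mem_preimage, mem_singleton_iff] at hp
        exact R.symm (hp ▸ p.2 : R y p.1.2)
      · intro p hp q hq h
        exact Subtype.ext (Prod.ext (hp.trans hq.symm) h))
  obtain ⟨C, hC, hCu⟩ := exists_iUnion_injOn_of_countable_fibers
    (f := fun p : {p : X × X | R p.1 p.2} => p.1.2) (measurable_snd.comp measurable_subtype_coe)
    (fun y => by
      refine MapsTo.countable_of_injOn (f := fun p => p.1.1) (fun p hp => ?_) ?_ (hc y)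
      · rw [mem_preimage, mem_singleton_iff] at hp
        exact (hp ▸ p.2 : R p.1.1 y)
      · intro p hp q hq h
        exact Subtype.ext (Prod.ext h (hp.trans hq.symm)))
  let ν : X → ℕ → Bool := MeasurableSpace.mapNatBool X
  have hν : Measurable ν := MeasurableSpace.measurable_mapNatBool X
  -- Both projections are injective on `B n ∩ C m`. Requiring the `k`-th bit of a point-separating
  -- code to be `b` on the left and not on the right makes domain and range disjoint. Every
  -- off-diagonal pair of `R` is caught, as its codes differ at some bit.
  let E (i : ℕ × ℕ × ℕ × Bool) : Set (X × X) :=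
    Subtype.val '' (B i.1 ∩ C i.2.1) ∩ {p | ν p.1 i.2.2.1 = i.2.2.2 ∧ ν p.2 i.2.2.1 ≠ i.2.2.2}
  have hEm : ∀ i, MeasurableSet (E i) := by
    intro i
    have hb : ∀ k, Measurable fun x => ν x k := fun k => (measurable_pi_apply k).comp hν
    have h1 : MeasurableSet {p : X × X | ν p.1 i.2.2.1 = i.2.2.2} :=
      ((hb i.2.2.1).comp measurable_fst) (measurableSet_singleton i.2.2.2)
    have h2 : MeasurableSet {p : X × X | ν p.2 i.2.2.1 = i.2.2.2} :=
      ((hb i.2.2.1).comp measurable_snd) (measurableSet_singleton i.2.2.2)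
    exact (hR.subtype_image ((hB _).1.inter (hC _).1)).inter (h1.inter h2.compl)
  have key := fun i => exists_involution_of_graph (hEm i)
    (by
      rintro _ ⟨⟨p, hp, rfl⟩, -⟩ _ ⟨⟨q, hq, rfl⟩, -⟩ h
      exact congrArg _ ((hB _).2 hp.1 hq.1 h))
    (by
      rintro _ ⟨⟨p, hp, rfl⟩, -⟩ _ ⟨⟨q, hq, rfl⟩, -⟩ h
      exact congrArg _ ((hC _).2 hp.2 hq.2 h))
    (by
      rw [Set.disjoint_left]
      rintro _ ⟨p, hp, rfl⟩ ⟨q, hq, h⟩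
      exact hq.2.2 (h ▸ hp.2.1))
  choose e he₁ he₂ using key
  have hER : ∀ i x y, (x, y) ∈ E i → R x y := by
    rintro i x y ⟨⟨p, -, hp⟩, -⟩
    have := p.2
    rw [hp] at this
    exact this
  obtain ⟨s, hs⟩ := exists_surjective_nat (ℕ × ℕ × ℕ × Bool)
  refine ⟨fun n => e (s n), fun n x => ?_, fun x y hxy hne => ?_⟩
  · rcases he₂ (s n) x with h | h | h
    · rw [h]
    · exact R.symm (hER _ _ _ h)
    · exact hER _ _ _ h
  · obtain ⟨n, hn⟩ := mem_iUnion.1 (hBu ▸ mem_univ (⟨(x, y), hxy⟩ : {p : X × X | R p.1 p.2}))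
    obtain ⟨m, hm⟩ := mem_iUnion.1 (hCu ▸ mem_univ (⟨(x, y), hxy⟩ : {p : X × X | R p.1 p.2}))
    have : ν x ≠ ν y := fun h => hne (MeasurableSpace.injective_mapNatBool X h)
    obtain ⟨k, hk⟩ := Function.ne_iff.1 this
    obtain ⟨i, hi⟩ := hs (n, m, k, ν x k)
    refine ⟨i, he₁ _ _ _ ?_⟩
    rw [hi]
    exact ⟨⟨_, ⟨hn, hm⟩, rfl⟩, rfl, hk.symm⟩

end FeldmanMoore

/-! ### Semidirect products from homomorphic sections. -/

namespace ArrowGroupoid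

section Splitting

variable {X G : Type u} {𝒢 : ArrowGroupoid X G}

/-- The set of arrows with target `x` and source `y`. -/
structure Arr (𝒢 : ArrowGroupoid X G) (x y : X) : Type u where
  val : G
  tgt_val : 𝒢.tgt val = x
  src_val : 𝒢.src val = y

theorem Arr.ext_val {x y : X} {f g : 𝒢.Arr x y} (h : f.val = g.val) : f = g := by
  cases f; cases g; cases h; rfl

/-- Composition of arrows. -/
def Arr.comp {x y z : X} (f : 𝒢.Arr x y) (g : 𝒢.Arr y z) : 𝒢.Arr x z :=
  ⟨𝒢.mul f.val g.val (f.src_val.trans g.tgt_val.symm),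
    (𝒢.tgt_mul _ _ _).trans f.tgt_val, (𝒢.src_mul _ _ _).trans g.src_val⟩

/-- The unit arrow. -/
def Arr.id (𝒢 : ArrowGroupoid X G) (x : X) : 𝒢.Arr x x := ⟨𝒢.unit x, 𝒢.tgt_unit x, 𝒢.src_unit x⟩

/-- The inverse arrow. -/
def Arr.inv {x y : X} (f : 𝒢.Arr x y) : 𝒢.Arr y x :=
  ⟨𝒢.inv f.val, (𝒢.tgt_inv _).trans f.src_val, (𝒢.src_inv _).trans f.tgt_val⟩

theorem Arr.comp_assoc {x y z w : X} (f : 𝒢.Arr x y) (g : 𝒢.Arr y z) (h : 𝒢.Arr z w) :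
    (f.comp g).comp h = f.comp (g.comp h) :=
  Arr.ext_val (𝒢.mul_assoc f.val g.val h.val _ _)

theorem Arr.id_comp {x y : X} (f : 𝒢.Arr x y) : (Arr.id 𝒢 x).comp f = f :=
  Arr.ext_val (𝒢.unit_mul_of_tgt _ f.val f.tgt_val)

theorem Arr.comp_id {x y : X} (f : 𝒢.Arr x y) : f.comp (Arr.id 𝒢 y) = f :=
  Arr.ext_val (𝒢.mul_unit_of_src _ f.val f.src_val)

theorem Arr.inv_comp {x y : X} (f : 𝒢.Arr x y) : f.inv.comp f = Arr.id 𝒢 y :=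
  Arr.ext_val (𝒢.inv_mul_of_src _ f.val f.src_val)

theorem Arr.comp_inv {x y : X} (f : 𝒢.Arr x y) : f.comp f.inv = Arr.id 𝒢 x := by
  obtain ⟨g, rfl, hs⟩ := f
  exact Arr.ext_val (𝒢.mul_inv g)

/-- An isotropy element as an arrow. -/
def Isotropy.arr {x : X} (g : 𝒢.Isotropy x) : 𝒢.Arr x x := ⟨g.val, g.tgt_val, g.src_val⟩

/-- An arrow from `x` to itself as an isotropy element. -/
def Arr.iso {x : X} (g : 𝒢.Arr x x) : 𝒢.Isotropy x := ⟨g.val, g.src_val, g.tgt_val⟩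

theorem Arr.iso_comp {x : X} (g h : 𝒢.Arr x x) : (g.comp h).iso = g.iso * h.iso := rfl

theorem measurable_mul_comp [MeasurableSpace G]
    (hm : Measurable fun p : {p : G × G // 𝒢.src p.1 = 𝒢.tgt p.2} => 𝒢.mul p.1.1 p.1.2 p.2)
    {Ω : Type*} [MeasurableSpace Ω] {a b : Ω → G} (ha : Measurable a) (hb : Measurable b)
    (e : ∀ ω, 𝒢.src (a ω) = 𝒢.tgt (b ω)) : Measurable fun ω => 𝒢.mul (a ω) (b ω) (e ω) :=
  hm.comp ((ha.prodMk hb).subtype_mk (h := e))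

/-- Conjugation by a groupoid homomorphism from `R` to `𝒢` that is the identity on units. -/
def conj {R : Setoid X} (θ : ∀ x y, R x y → 𝒢.Arr x y)
    (hθ : ∀ x y z hxy hyz, (θ x y hxy).comp (θ y z hyz) = θ x z (R.trans hxy hyz))
    (hθ1 : ∀ x h, θ x x h = Arr.id 𝒢 x) (x y : X) (h : R x y) :
    𝒢.Isotropy y ≃* 𝒢.Isotropy x where
  toFun g := ((θ x y h).comp (g.arr.comp (θ y x (R.symm h)))).iso
  invFun g := ((θ y x (R.symm h)).comp (g.arr.comp (θ x y h))).iso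
  left_inv g := by
    change ((θ y x _).comp (((θ x y h).comp (g.arr.comp (θ y x _))).comp (θ x y h))).iso = g
    rw [Arr.comp_assoc, Arr.comp_assoc, hθ, hθ1, Arr.comp_id, ← Arr.comp_assoc, hθ, hθ1,
      Arr.id_comp]
    rfl
  right_inv g := by
    change ((θ x y _).comp (((θ y x _).comp (g.arr.comp (θ x y _))).comp (θ y x _))).iso = g
    rw [Arr.comp_assoc, Arr.comp_assoc, hθ, hθ1, Arr.comp_id, ← Arr.comp_assoc, hθ, hθ1,
      Arr.id_comp]
    rfl
  map_mul' g k := by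
    rw [← Arr.iso_comp]
    change ((θ x y _).comp ((g.arr.comp k.arr).comp (θ y x _))).iso = _
    congr 1
    rw [Arr.comp_assoc (θ x y h), Arr.comp_assoc g.arr, Arr.comp_assoc g.arr,
      ← Arr.comp_assoc (θ y x _) (θ x y h), hθ, hθ1, Arr.id_comp]

/-- A Borel groupoid homomorphism from `R` to `𝒢` that is the identity on units splits `𝒢` as a
semidirect product. -/
theorem isStrictSemidirectProduct_of_section [MeasurableSpace X] [MeasurableSpace G]
    (𝒢 : ArrowGroupoid X G) (R : Setoid X) (hs : Measurable 𝒢.src) (ht : Measurable 𝒢.tgt)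
    (hm : Measurable fun p : {p : G × G // 𝒢.src p.1 = 𝒢.tgt p.2} => 𝒢.mul p.1.1 p.1.2 p.2)
    (hR : ∀ g, R (𝒢.tgt g) (𝒢.src g))
    (θ : ∀ x y, R x y → 𝒢.Arr x y)
    (hθ : ∀ x y z hxy hyz, (θ x y hxy).comp (θ y z hyz) = θ x z (R.trans hxy hyz))
    (hθm : Measurable fun p : {p : X × X // R p.1 p.2} => (θ p.1.1 p.1.2 p.2).val) :
    𝒢.IsStrictSemidirectProduct R := by
  -- The arrow `θ x x h` is idempotent, and the only idempotents of a groupoid are the units.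
  have hθ1 : ∀ x h, θ x x h = Arr.id 𝒢 x := by
    intro x h
    have := congrArg ((θ x x h).inv.comp ·) (hθ x x x h h)
    simpa only [← Arr.comp_assoc, Arr.inv_comp, Arr.id_comp] using this
  let δ : 𝒢.IsotropyAction R :=
    { map := conj θ hθ hθ1
      map_map := fun x y z hxy hyz g => by
        change ((θ x y _).comp (((θ y z _).comp (g.arr.comp (θ z y _))).comp (θ y x _))).iso =
          ((θ x z _).comp (g.arr.comp (θ z x _))).iso
        rw [Arr.comp_assoc, Arr.comp_assoc, hθ, ← Arr.comp_assoc, hθ]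
      measurable_map :=
        measurable_mul_comp hm (hθm.comp ((measurable_fst.comp
          measurable_subtype_coe).subtype_mk (h := fun p => p.2.1))) (measurable_mul_comp hm
            (measurable_snd.comp measurable_subtype_coe) (hθm.comp ((measurable_swap.comp
              (measurable_fst.comp measurable_subtype_coe)).subtype_mk
                (h := fun p => R.symm p.2.1))) _) _ }
  let Φ : 𝒢.SemidirectArrow R ≃ᵐ G :=
    { toFun := fun p => (p.iso.arr.comp (θ p.1.1.1 p.1.1.2 p.2.1)).val
      invFun := fun g => SemidirectArrow.mk (𝒢.tgt g) (𝒢.src g) (hR g)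
        ((Arr.mk g rfl rfl).comp (θ (𝒢.src g) (𝒢.tgt g) (R.symm (hR g)))).iso
      left_inv := fun p => by
        -- The endpoints are made variables, so that they can be replaced by the target and source
        -- of `g`.
        have key : ∀ (x y : X) (h : R x y) (g : 𝒢.Arr x y) (h' : R (𝒢.tgt g.val) (𝒢.src g.val)),
            SemidirectArrow.mk (𝒢.tgt g.val) (𝒢.src g.val) h'
              ((Arr.mk g.val rfl rfl).comp (θ (𝒢.src g.val) (𝒢.tgt g.val) (R.symm h'))).iso =
            SemidirectArrow.mk x y h (g.comp (θ y x (R.symm h))).iso := by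
          rintro x y h ⟨g, rfl, rfl⟩ h'
          rfl
        refine (key _ _ p.2.1 (p.iso.arr.comp (θ p.1.1.1 p.1.1.2 p.2.1)) (hR _)).trans ?_
        rw [Arr.comp_assoc, hθ, hθ1, Arr.comp_id]
        rfl
      right_inv := fun g => by
        change (((Arr.mk g rfl rfl).comp (θ (𝒢.src g) (𝒢.tgt g) (R.symm (hR g)))).comp
          (θ (𝒢.tgt g) (𝒢.src g) (hR g))).val = g
        rw [Arr.comp_assoc, hθ, hθ1, Arr.comp_id]
      measurable_toFun :=
        measurable_mul_comp hm (measurable_snd.comp measurable_subtype_coe) (hθm.comp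
          ((measurable_fst.comp measurable_subtype_coe).subtype_mk (h := fun p => p.2.1))) _
      measurable_invFun := by
        refine Measurable.subtype_mk (Measurable.prodMk (ht.prodMk hs) ?_)
        exact measurable_mul_comp hm measurable_id (hθm.comp ((hs.prodMk ht).subtype_mk
          (h := fun g => R.symm (hR g)))) _ }
  refine ⟨δ, ⟨Φ, fun p => (p.iso.arr.comp (θ p.1.1.1 p.1.1.2 p.2.1)).src_val,
    fun p => (p.iso.arr.comp (θ p.1.1.1 p.1.1.2 p.2.1)).tgt_val, ?_⟩, fun x g => ?_⟩
  · rintro ⟨⟨⟨x, y⟩, g⟩, hxy, hg⟩ ⟨⟨⟨y', z⟩, h⟩, hyz, hh⟩ e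
    obtain rfl : y = y' := e
    let g' : 𝒢.Arr x x := ⟨g, hg.2, hg.1⟩
    let h' : 𝒢.Arr y y := ⟨h, hh.2, hh.1⟩
    change ((g'.comp ((θ x y hxy).comp (h'.comp (θ y x (R.symm hxy))))).comp
      (θ x z (R.trans hxy hyz))).val =
      ((g'.comp (θ x y hxy)).comp (h'.comp (θ y z hyz))).val
    rw [Arr.comp_assoc, Arr.comp_assoc, Arr.comp_assoc, Arr.comp_assoc, hθ]
  · change (g.arr.comp (θ x x (R.refl x))).val = g.val
    rw [hθ1, Arr.comp_id]
    rfl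

end Splitting

end ArrowGroupoid

/-! ### Borel transversals of countable-to-one maps. -/

section Transversal

open Set

/-- A countable-to-one Borel map has a Borel transversal to its fibers. -/
theorem exists_measurableSet_injOn_image_eq_range {G Y : Type*} [MeasurableSpace G]
    [StandardBorelSpace G] [MeasurableSpace Y] [StandardBorelSpace Y] {f : G → Y}
    (hf : Measurable f) (hc : ∀ y, (f ⁻¹' {y}).Countable) :
    ∃ B, MeasurableSet B ∧ InjOn f B ∧ ∀ g, ∃ b ∈ B, f b = f g := by
  classical
  obtain ⟨B, hB, hBu⟩ := exists_iUnion_injOn_of_countable_fibers hf hc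
  -- From each injectivity piece, only the points whose value is not attained on an earlier piece
  -- are kept.
  refine ⟨⋃ n, B n ∩ f ⁻¹' (⋃ m, ⋃ _ : m < n, f '' B m)ᶜ, .iUnion fun n => (hB n).1.inter
    (hf (MeasurableSet.compl (.iUnion fun m => .iUnion fun _ =>
      (hB m).1.image_of_measurable_injOn hf (hB m).2))), ?_, ?_⟩
  · intro a ha b hb hab
    obtain ⟨n, ha, ha'⟩ := mem_iUnion.1 ha
    obtain ⟨m, hb, hb'⟩ := mem_iUnion.1 hb
    simp only [mem_preimage, mem_compl_iff, mem_iUnion, not_exists] at ha' hb'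
    rcases lt_trichotomy n m with h | rfl | h
    · exact absurd ⟨a, ha, hab⟩ (hb' n h)
    · exact (hB n).2 ha hb hab
    · exact absurd ⟨b, hb, hab.symm⟩ (ha' m h)
  · intro g
    have hex : ∃ n, f g ∈ f '' B n := by
      obtain ⟨n, hn⟩ := mem_iUnion.1 (hBu ▸ mem_univ g)
      exact ⟨n, g, hn, rfl⟩
    obtain ⟨b, hb, hbg⟩ := Nat.find_spec hex
    refine ⟨b, mem_iUnion.2 ⟨Nat.find hex, hb, ?_⟩, hbg⟩
    simp only [mem_preimage, mem_compl_iff, mem_iUnion, not_exists]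
    intro m hm h
    exact Nat.find_min hex hm (hbg ▸ h)

end Transversal

/-! ### Extending arrows over the edges of a forest to a section. -/

namespace ArrowGroupoid

section Tree

variable {X G : Type u} {𝒢 : ArrowGroupoid X G}

theorem Arr.eq_of_comp_eq {x y z : X} {f g : 𝒢.Arr x y} {h : 𝒢.Arr y z} (e : f.comp h = g.comp h) :
    f = g := by
  have := congrArg (·.comp h.inv) e
  simpa only [Arr.comp_assoc, Arr.comp_inv, Arr.comp_id] using this

theorem Arr.inv_inv {x y : X} (f : 𝒢.Arr x y) : f.inv.inv = f :=
  Arr.eq_of_comp_eq (h := f.inv) (by rw [Arr.inv_comp, Arr.comp_inv])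

theorem inv_inv (g : G) : 𝒢.inv (𝒢.inv g) = g :=
  congrArg Arr.val (Arr.inv_inv (Arr.mk g rfl rfl : 𝒢.Arr _ _))

/-- The product of the arrows `τ` along a walk. -/
def walkArr {T : SimpleGraph X} (τ : ∀ x y, T.Adj x y → 𝒢.Arr x y) :
    ∀ {x y : X}, T.Walk x y → 𝒢.Arr x y
  | x, _, .nil => Arr.id 𝒢 x
  | _, _, .cons h p => (τ _ _ h).comp (walkArr τ p)

/-- On a forest, a compatible choice of arrows over the edges is a coboundary. -/
theorem exists_potential {T : SimpleGraph X} (hT : T.IsAcyclic)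
    (τ : ∀ x y, T.Adj x y → 𝒢.Arr x y) (hτ : ∀ x y h, τ y x h.symm = (τ x y h).inv) (r : X) :
    ∃ h : ∀ x, T.Reachable x r → 𝒢.Arr x r, ∀ x y e hx hy, h x hx = (τ x y e).comp (h y hy) := by
  classical
  have hp : ∀ x, T.Reachable x r → ∃ p : T.Walk x r, p.IsPath := fun x ⟨p⟩ => ⟨_, p.bypass_isPath⟩
  choose p hp using hp
  refine ⟨fun x hx => walkArr τ (p x hx), ?_⟩
  have huniq : ∀ x hx (q : T.Walk x r), q.IsPath → p x hx = q := fun x hx q hq =>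
    congrArg Subtype.val ((hT.subsingleton_path x r).elim ⟨p x hx, hp x hx⟩ ⟨q, hq⟩)
  have key : ∀ x y (e : T.Adj x y) hx hy, x ∉ (p y hy).support →
      walkArr τ (p x hx) = (τ x y e).comp (walkArr τ (p y hy)) := by
    intro x y e hx hy h
    rw [huniq x hx (.cons e (p y hy)) ((hp y hy).cons h)]
    rfl
  intro x y e hx hy
  change walkArr τ (p x hx) = (τ x y e).comp (walkArr τ (p y hy))
  -- If the path from `y` to `r` meets its neighbour `x`, acyclicity forces it to start with the
  -- edge to `x`. The rest is the path from `x`, which avoids `y`, so `key` applies to the reversed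
  -- edge.
  by_cases h : x ∈ (p y hy).support
  · have h' : y ∉ (p x hx).support := by
      intro h'
      have h1 := hT.eq_snd_of_adj_start (hp y hy) e.symm h
      have hpy := hp y hy
      generalize p y hy = q at h h1 hpy
      cases q with
      | nil => simp at h; exact e.ne h
      | cons e' q =>
        simp only [SimpleGraph.Walk.snd_cons] at h1
        subst h1
        rw [SimpleGraph.Walk.cons_isPath_iff] at hpy
        rw [huniq _ hx q hpy.1] at h'
        exact hpy.2 h'
    rw [key y x e.symm hy hx h', hτ x y e, ← Arr.comp_assoc, Arr.comp_inv, Arr.id_comp]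
  · exact key x y e hx hy h

/-- The set of products of an element of `L` and an element of `W`. -/
def mulSet (𝒢 : ArrowGroupoid X G) (L W : Set G) : Set G :=
  {g | ∃ l ∈ L, ∃ w ∈ W, ∃ e : 𝒢.src l = 𝒢.tgt w, 𝒢.mul l w e = g}

/-- Writing `W` as a continuous image of a Polish space `β` turns the product set into the image,
under a Borel map, of a Borel subset of `G × β`. -/
theorem analyticSet_mulSet [MeasurableSpace X] [StandardBorelSpace X] [TopologicalSpace G]
    [PolishSpace G] [MeasurableSpace G] [BorelSpace G] (hs : Measurable 𝒢.src)
    (ht : Measurable 𝒢.tgt)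
    (hm : Measurable fun p : {p : G × G // 𝒢.src p.1 = 𝒢.tgt p.2} => 𝒢.mul p.1.1 p.1.2 p.2)
    {L W : Set G} (hL : MeasurableSet L) (hW : AnalyticSet W) : AnalyticSet (𝒢.mulSet L W) := by
  obtain ⟨β, _, _, ρ, hρ, rfl⟩ := analyticSet_iff_exists_polishSpace_range.1 hW
  let _ : MeasurableSpace β := borel β
  have : BorelSpace β := ⟨rfl⟩
  let Y : Set (G × β) := {p | p.1 ∈ L ∧ 𝒢.src p.1 = 𝒢.tgt (ρ p.2)}
  have hY : MeasurableSet Y := (measurable_fst hL).inter (measurableSet_eq_fun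
    (hs.comp measurable_fst) (ht.comp (hρ.measurable.comp measurable_snd)))
  have := hY.standardBorel
  have hmeas : Measurable fun p : Y => 𝒢.mul p.1.1 (ρ p.1.2) p.2.2 :=
    measurable_mul_comp hm (measurable_fst.comp measurable_subtype_coe)
      (hρ.measurable.comp (measurable_snd.comp measurable_subtype_coe)) _
  convert! MeasurableSet.univ.analyticSet_image hmeas
  ext g
  constructor
  · rintro ⟨l, hl, _, ⟨b, rfl⟩, e, rfl⟩
    exact ⟨⟨(l, b), hl, e⟩, trivial, rfl⟩
  · rintro ⟨⟨⟨l, b⟩, hl, e⟩, -, rfl⟩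
    exact ⟨l, hl, _, ⟨b, rfl⟩, e, rfl⟩

/-- A groupoid over an equivalence relation generated by a Borel forest splits. -/
theorem isStrictSemidirectProduct_of_isAcyclic [MeasurableSpace X] [StandardBorelSpace X]
    [MeasurableSpace G] [StandardBorelSpace G] (R : Setoid X)
    (hu : Measurable 𝒢.unit) (hs : Measurable 𝒢.src) (ht : Measurable 𝒢.tgt)
    (hm : Measurable fun p : {p : G × G // 𝒢.src p.1 = 𝒢.tgt p.2} => 𝒢.mul p.1.1 p.1.2 p.2)
    (hi : Measurable 𝒢.inv) (hc : ∀ x, (𝒢.src ⁻¹' {x}).Countable)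
    (hR : ∀ x y, R x y ↔ ∃ g, 𝒢.tgt g = x ∧ 𝒢.src g = y)
    {T : SimpleGraph X} (hTm : MeasurableSet {p : X × X | T.Adj p.1 p.2}) (hT : T.IsAcyclic)
    (hTR : ∀ x y, R x y ↔ T.Reachable x y) : 𝒢.IsStrictSemidirectProduct R := by
  let _ := upgradeStandardBorel G
  have hπ : Measurable fun g => (𝒢.tgt g, 𝒢.src g) := ht.prodMk hs
  obtain ⟨B, hBm, hBi, hB⟩ := exists_measurableSet_injOn_image_eq_range hπ
    (fun y => (hc y.2).mono fun g hg => congrArg Prod.snd hg)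
  -- A Borel linear order on `X` orients each edge, so that the transversal `B` supplies the arrow
  -- in one direction and its inverse is used in the other.
  let ν : X → ℝ := embeddingReal X
  have hν : Measurable ν := measurable_embeddingReal X
  have hνi : Function.Injective ν := (measurableEmbedding_embeddingReal X).injective
  let E : Set G := {g | g ∈ B ∧ T.Adj (𝒢.tgt g) (𝒢.src g) ∧ ν (𝒢.tgt g) < ν (𝒢.src g)}
  have hE : MeasurableSet E := hBm.inter ((hπ hTm).inter
    (measurableSet_lt (hν.comp ht) (hν.comp hs)))
  let L : Set G := E ∪ 𝒢.inv ⁻¹' E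
  have hL : MeasurableSet L := hE.union (hi hE)
  have hLi : ∀ g ∈ L, 𝒢.inv g ∈ L := by
    rintro g (h | h)
    · exact .inr (by rwa [Set.mem_preimage, inv_inv])
    · exact .inl h
  have hτ : ∀ x y, T.Adj x y → ∃ a : 𝒢.Arr x y, a.val ∈ L := by
    have key : ∀ x y, T.Adj x y → ν x < ν y → ∃ a : 𝒢.Arr x y, a.val ∈ E := by
      intro x y h hlt
      obtain ⟨g, rfl, rfl⟩ := (hR x y).1 ((hTR x y).2 h.reachable)
      obtain ⟨b, hb, hbg⟩ := hB g
      have h1 := congrArg Prod.fst hbg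
      have h2 := congrArg Prod.snd hbg
      dsimp only at h1 h2
      exact ⟨⟨b, h1, h2⟩, hb, by rwa [h1, h2], by rwa [h1, h2]⟩
    intro x y h
    rcases lt_trichotomy (ν x) (ν y) with hlt | heq | hlt
    · obtain ⟨a, ha⟩ := key x y h hlt
      exact ⟨a, .inl ha⟩
    · exact absurd (hνi heq) h.ne
    · obtain ⟨a, ha⟩ := key y x h.symm hlt
      exact ⟨a.inv, hLi _ (.inl ha)⟩
  have hLadj : ∀ g ∈ L, T.Adj (𝒢.tgt g) (𝒢.src g) := by
    rintro g (h | h)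
    · exact h.2.1
    · have := h.2.1
      rw [tgt_inv, src_inv] at this
      exact this.symm
  have hLu : ∀ x y (a b : 𝒢.Arr x y), a.val ∈ L → b.val ∈ L → a = b := by
    have hlt : ∀ x y (a : 𝒢.Arr x y), a.val ∈ E → ν x < ν y := by
      intro x y a ha
      have := ha.2.2
      rwa [a.tgt_val, a.src_val] at this
    have key : ∀ x y (a b : 𝒢.Arr x y), a.val ∈ E → b.val ∈ E → a = b := by
      intro x y a b ha hb
      exact Arr.ext_val (hBi ha.1 hb.1 (by simp only [a.tgt_val, a.src_val, b.tgt_val, b.src_val]))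
    rintro x y a b (ha | ha) (hb | hb)
    · exact key _ _ _ _ ha hb
    · exact absurd (hlt _ _ _ ha) (hlt _ _ b.inv hb).not_gt
    · exact absurd (hlt _ _ _ hb) (hlt _ _ a.inv ha).not_gt
    · rw [← a.inv_inv, ← b.inv_inv, key _ _ a.inv b.inv ha hb]
  choose τ hτL using hτ
  have hτi : ∀ x y h, τ y x h.symm = (τ x y h).inv := fun x y h =>
    hLu _ _ _ _ (hτL _ _ _) (hLi _ (hτL _ _ _))
  -- Products of `n` chosen arrows. Such a product from `y` to `x` must equal `h x (h y)⁻¹` for a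
  -- potential `h`, so it depends only on `x` and `y`.
  let W (n : ℕ) : Set G := Nat.rec (Set.range 𝒢.unit) (fun _ W => 𝒢.mulSet L W) n
  have hWa : ∀ n, AnalyticSet (W n) := by
    intro n
    induction n with
    | zero =>
      change AnalyticSet (Set.range 𝒢.unit)
      rw [← Set.image_univ]
      exact MeasurableSet.univ.analyticSet_image hu
    | succ n ih => exact analyticSet_mulSet hs ht hm hL ih
  have hWu : ∀ r (h : ∀ x, T.Reachable x r → 𝒢.Arr x r),
      (∀ x y e hx hy, h x hx = (τ x y e).comp (h y hy)) → ∀ n, ∀ x y (a : 𝒢.Arr x y),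
      a.val ∈ W n → ∀ hx hy, h x hx = a.comp (h y hy) := by
    intro r h hh n
    induction n with
    | zero =>
      rintro x y ⟨_, rfl, rfl⟩ ⟨z, rfl⟩ hx hy
      have : ∀ z' z'' (e : z' = z) (e' : z'' = z) hx hy,
          h z' hx = (Arr.mk (𝒢.unit z) ((𝒢.tgt_unit z).trans e.symm)
            ((𝒢.src_unit z).trans e'.symm)).comp (h z'' hy) := by
        rintro _ _ rfl rfl hx hy
        exact (Arr.id_comp _).symm
      exact this _ _ (𝒢.tgt_unit z) (𝒢.src_unit z) hx hy
    | succ n ih =>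
      rintro x y ⟨_, rfl, rfl⟩ ⟨l, hl, w, hw, e, rfl⟩ hx hy
      have hadj := hLadj l hl
      have : ∀ x y z (hadj : T.Adj x z) (a : 𝒢.Arr x z) (b : 𝒢.Arr z y), a.val ∈ L → b.val ∈ W n →
          ∀ hx hy, h x hx = (a.comp b).comp (h y hy) := by
        intro x y z hadj a b ha hb hx hy
        rw [Arr.comp_assoc, ← ih z y b hb (hadj.symm.reachable.trans hx) hy,
          hLu _ _ a (τ x z hadj) ha (hτL _ _ _)]
        exact hh x z hadj _ _
      have hx' : 𝒢.tgt (𝒢.mul l w e) = 𝒢.tgt l := 𝒢.tgt_mul _ _ _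
      exact this _ _ (𝒢.src l) (by rw [hx']; exact hadj) ⟨l, hx'.symm, rfl⟩
        ⟨w, e.symm, (𝒢.src_mul _ _ _).symm⟩ hl hw hx hy
  have hWex : ∀ x y, R x y → ∃ a : 𝒢.Arr x y, a.val ∈ ⋃ n, W n := by
    intro x y h
    obtain ⟨p⟩ := (hTR x y).1 h
    clear h
    induction p with
    | nil => exact ⟨Arr.id 𝒢 _, Set.mem_iUnion.2 ⟨0, _, rfl⟩⟩
    | cons h p ih =>
      obtain ⟨a, ha⟩ := ih
      obtain ⟨n, hn⟩ := Set.mem_iUnion.1 ha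
      exact ⟨(τ _ _ h).comp a, Set.mem_iUnion.2 ⟨n + 1, _, hτL _ _ h, _, hn, _, rfl⟩⟩
  choose θ hθ using hWex
  have hpot : ∀ r, ∃ h : ∀ x, T.Reachable x r → 𝒢.Arr x r, ∀ x y (a : 𝒢.Arr x y),
      a.val ∈ (⋃ n, W n) → ∀ hx hy, h x hx = a.comp (h y hy) := by
    intro r
    obtain ⟨h, hh⟩ := exists_potential hT τ hτi r
    refine ⟨h, fun x y a ha => ?_⟩
    obtain ⟨n, hn⟩ := Set.mem_iUnion.1 ha
    exact hWu r h hh n x y a hn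
  have hθc : ∀ x y z hxy hyz, (θ x y hxy).comp (θ y z hyz) = θ x z (R.trans hxy hyz) := by
    intro x y z hxy hyz
    obtain ⟨h, hh⟩ := hpot z
    have hx := (hTR x z).1 (R.trans hxy hyz)
    have hy := (hTR y z).1 hyz
    have hz := (hTR z z).1 (R.refl z)
    refine Arr.eq_of_comp_eq (h := h z hz) ?_
    rw [← hh _ _ _ (hθ _ _ _) hx hz, Arr.comp_assoc, ← hh _ _ _ (hθ _ _ _) hy hz,
      ← hh _ _ _ (hθ _ _ _) hx hy]
  have hθu : ∀ x y hxy (a : 𝒢.Arr x y), a.val ∈ (⋃ n, W n) → a = θ x y hxy := by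
    intro x y hxy a ha
    obtain ⟨h, hh⟩ := hpot y
    have hx := (hTR x y).1 hxy
    have hy := (hTR y y).1 (R.refl y)
    refine Arr.eq_of_comp_eq (h := h y hy) ?_
    rw [← hh _ _ _ (hθ _ _ _) hx hy, ← hh _ _ _ ha hx hy]
  have hR' : ∀ g, R (𝒢.tgt g) (𝒢.src g) := fun g => (hR _ _).2 ⟨g, rfl, rfl⟩
  refine isStrictSemidirectProduct_of_section 𝒢 R hs ht hm hR' θ hθc ?_
  obtain ⟨β, _, _, ρ, hρ, hρr⟩ :=
    analyticSet_iff_exists_polishSpace_range.1 (AnalyticSet.iUnion hWa)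
  let _ : MeasurableSpace β := borel β
  have : BorelSpace β := ⟨rfl⟩
  -- With the analytic set of products parametrized by `ρ : β → G`, the map `π` is a Borel
  -- surjection and `θ ∘ π = ρ` is Borel. This forces `θ` to be Borel.
  let π : β → {p : X × X // R p.1 p.2} := fun b => ⟨(𝒢.tgt (ρ b), 𝒢.src (ρ b)), hR' _⟩
  have hπm : Measurable π := (hπ.comp hρ.measurable).subtype_mk
  have hπs : Function.Surjective π := by
    rintro ⟨⟨x, y⟩, h⟩
    obtain ⟨b, hb⟩ : (θ x y h).val ∈ Set.range ρ := hρr ▸ hθ x y h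
    refine ⟨b, Subtype.ext (Prod.ext ?_ ?_)⟩
    · change 𝒢.tgt (ρ b) = x
      rw [hb, (θ x y h).tgt_val]
    · change 𝒢.src (ρ b) = y
      rw [hb, (θ x y h).src_val]
  rw [← hπm.measurable_comp_iff_of_surjective hπs]
  convert hρ.measurable using 1
  funext b
  exact (congrArg Arr.val (hθu _ _ (hR' (ρ b)) ⟨ρ b, rfl, rfl⟩ (hρr ▸ ⟨b, rfl⟩))).symm

end Tree

end ArrowGroupoid

/-! ### Treeable relations: every groupoid splits. -/

section Treeable

open ArrowGroupoid

/-- For a countable nonsingular equivalence relation, every null set is contained in an invariant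
Borel null set. -/
theorem IsCountableNonsingular.exists_invariant_superset {X : Type u} [MeasurableSpace X]
    {R : Setoid X} {μ : Measure X} (hR : IsCountableNonsingular R μ) {N : Set X} (hN : μ N = 0) :
    ∃ N', MeasurableSet N' ∧ μ N' = 0 ∧ N ⊆ N' ∧ ∀ x y, R x y → (x ∈ N' ↔ y ∈ N') := by
  let sat (S : Set X) : Set X := {x | ∃ y ∈ S, R x y}
  -- Each saturation is enlarged to a Borel null set before it is saturated again; the union of the
  -- sequence is invariant.
  let S (n : ℕ) : Set X := Nat.rec (toMeasurable μ N) (fun _ S => toMeasurable μ (sat S)) n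
  have hSm : ∀ n, MeasurableSet (S n) := by
    rintro (_ | n) <;> exact measurableSet_toMeasurable _ _
  have hS0 : ∀ n, μ (S n) = 0 := by
    intro n
    induction n with
    | zero => exact (measure_toMeasurable N).trans hN
    | succ n ih => exact (measure_toMeasurable _).trans (hR.null_saturation _ (hSm n) ih)
  have key : ∀ x y, R x y → x ∈ ⋃ n, S n → y ∈ ⋃ n, S n := by
    intro x y hxy hx
    obtain ⟨n, hn⟩ := Set.mem_iUnion.1 hx
    exact Set.mem_iUnion.2 ⟨n + 1, subset_toMeasurable μ _ ⟨x, hn, R.symm hxy⟩⟩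
  exact ⟨⋃ n, S n, .iUnion hSm, measure_iUnion_null hS0,
    (subset_toMeasurable μ N).trans (Set.subset_iUnion S 0),
    fun x y hxy => ⟨key x y hxy, key y x (R.symm hxy)⟩⟩

/-- On an invariant conull Borel set where the treeing behaves well everywhere, the induced graph is
a forest whose components are the classes, and the strict splitting applies. -/
theorem IsTreeable.isSemidirectProduct {X : Type u} [MeasurableSpace X] [StandardBorelSpace X]
    {μ : Measure X} {R : Setoid X} (hR : IsCountableNonsingular R μ) (hT : IsTreeable R μ)
    {G : Type u} [MeasurableSpace G] (𝒢 : DiscreteMeasuredGroupoid X G μ)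
    (h𝒢 : ∀ x y : X, R x y ↔ ∃ g : G, 𝒢.tgt g = x ∧ 𝒢.src g = y) :
    𝒢.toArrowGroupoid.IsSemidirectProduct R μ := by
  have := 𝒢.standardBorel
  obtain ⟨T, hTm, hTR, hae⟩ := hT
  obtain ⟨N, hNm, hN0, hsub, hNR⟩ := hR.exists_invariant_superset (ae_iff.1 hae)
  have hA : ∀ x ∈ Nᶜ, (T.connectedComponentMk x).toSimpleGraph.IsTree ∧
      (T.connectedComponentMk x).supp = {y : X | R y x} := by
    intro x hx
    by_contra h
    exact hx (hsub h)
  have hAR : ∀ x y : X, R x y → (x ∈ Nᶜ ↔ y ∈ Nᶜ) := fun x y h => not_congr (hNR x y h)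
  have hAm := hNm.compl
  refine ⟨Nᶜ, hAm, by rwa [compl_compl], hAR, ?_⟩
  generalize Nᶜ = A at hA hAR hAm
  have : StandardBorelSpace A := hAm.standardBorel
  have : StandardBorelSpace {g : G // 𝒢.src g ∈ A ∧ 𝒢.tgt g ∈ A} :=
    ((𝒢.measurable_src hAm).inter (𝒢.measurable_tgt hAm)).standardBorel
  refine isStrictSemidirectProduct_of_isAcyclic (T := T.induce A) _
    ((𝒢.measurableEmbedding_unit.measurable.comp measurable_subtype_coe).subtype_mk)
    ((𝒢.measurable_src.comp measurable_subtype_coe).subtype_mk)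
    ((𝒢.measurable_tgt.comp measurable_subtype_coe).subtype_mk)
    ?_ ((𝒢.measurable_inv.comp measurable_subtype_coe).subtype_mk) ?_ ?_ ?_ ?_ ?_
  · refine Measurable.subtype_mk ?_
    exact measurable_mul_comp 𝒢.measurable_mul
      (measurable_subtype_coe.comp (measurable_fst.comp measurable_subtype_coe))
      (measurable_subtype_coe.comp (measurable_snd.comp measurable_subtype_coe)) _
  · intro x
    refine Set.MapsTo.countable_of_injOn (f := Subtype.val) (t := 𝒢.src ⁻¹' {x.1}) ?_
      Subtype.val_injective.injOn (𝒢.countable_src_fiber _)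
    intro g hg
    exact congrArg Subtype.val hg
  · intro x y
    refine (h𝒢 x.1 y.1).trans ⟨?_, ?_⟩
    · rintro ⟨g, hx, hy⟩
      exact ⟨⟨g, hy ▸ y.2, hx ▸ x.2⟩, Subtype.ext hx, Subtype.ext hy⟩
    · rintro ⟨g, hx, hy⟩
      exact ⟨g.1, congrArg Subtype.val hx, congrArg Subtype.val hy⟩
  · exact (measurable_subtype_coe.comp measurable_fst).prodMk
      (measurable_subtype_coe.comp measurable_snd) hTm
  · intro v c hc
    have hc' : (c.map (SimpleGraph.Embedding.induce A).toHom).IsCycle :=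
      hc.map Subtype.val_injective
    set c' := c.map (SimpleGraph.Embedding.induce A).toHom with hcdef
    -- A cycle of `T` stays inside one component, where it contradicts the tree hypothesis.
    have hsupp : ∀ w ∈ c'.support, w ∈ (T.connectedComponentMk v.1).supp := by
      intro w hw
      classical
      exact SimpleGraph.ConnectedComponent.sound (c'.takeUntil w hw).reachable.symm
    have hind : (c'.induce _ hsupp).IsCycle := by
      refine SimpleGraph.Walk.IsCycle.of_map (f := (SimpleGraph.Embedding.induce _).toHom) ?_
      rw [SimpleGraph.Walk.map_induce]
      exact hc'
    exact (hA v.1 v.2).1.isAcyclic _ hind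
  · intro x y
    constructor
    · intro h
      have hxy : x.1 ∈ (T.connectedComponentMk y.1).supp := by
        rw [(hA y.1 y.2).2]; exact h
      obtain ⟨p⟩ := SimpleGraph.ConnectedComponent.exact hxy
      have hsupp : ∀ w ∈ p.support, w ∈ A := by
        intro w hw
        classical
        have : w ∈ (T.connectedComponentMk y.1).supp :=
          SimpleGraph.ConnectedComponent.sound (p.dropUntil w hw).reachable
        rw [(hA y.1 y.2).2] at this
        exact (hAR w y.1 this).2 y.2
      exact ⟨p.induce A hsupp⟩
    · rintro ⟨p⟩
      induction p with
      | nil => exact R.refl _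
      | cons h p ih => exact R.trans (hTR _ _ h) ih

end Treeable

/-! ### Equivariant nearest point projection in a Cayley graph and its contraction. -/

section NearestPoint

variable {F : Type*} [Group F]

/-- The graph on `F` whose edges are given by left multiplication with the letters `ℓ n`. -/
def leftCayley (ℓ : ℕ → F) : SimpleGraph F := SimpleGraph.fromRel fun u v => ∃ n, v = ℓ n * u

/-- `projRel ℓ W n u v` says that `v ∈ W` is reached from `u` in at most `n` steps, where each step
uses the first letter that decreases the distance to `W`. -/
def projRel (ℓ : ℕ → F) (W : Set F) : ℕ → F → F → Prop
  | 0, u, v => u ∈ W ∧ v = u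
  | n + 1, u, v => projRel ℓ W n u v ∨ ((∀ v', ¬ projRel ℓ W n u v') ∧
      ∃ k, projRel ℓ W n (ℓ k * u) v ∧ ∀ j < k, ∀ v', ¬ projRel ℓ W n (ℓ j * u) v')

variable {ℓ : ℕ → F} {W : Set F}

theorem projRel_mono {n m : ℕ} (h : n ≤ m) {u v : F} (huv : projRel ℓ W n u v) :
    projRel ℓ W m u v := by
  induction h with
  | refl => exact huv
  | step _ ih => exact .inl ih

theorem projRel_unique {n m : ℕ} {u v v' : F} (h : projRel ℓ W n u v) (h' : projRel ℓ W m u v') :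
    v = v' := by
  have key : ∀ n u v v', projRel ℓ W n u v → projRel ℓ W n u v' → v = v' := by
    intro n
    induction n with
    | zero => rintro u v v' ⟨-, rfl⟩ ⟨-, rfl⟩; rfl
    | succ n ih =>
      rintro u v v' (h | ⟨hn, k, hk, hlt⟩) (h' | ⟨hn', k', hk', hlt'⟩)
      · exact ih _ _ _ h h'
      · exact absurd h (hn' _)
      · exact absurd h' (hn _)
      · rcases lt_trichotomy k k' with hkk | rfl | hkk
        · exact absurd hk (hlt' _ hkk _)
        · exact ih _ _ _ hk hk'
        · exact absurd hk' (hlt _ hkk _)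
  exact key _ _ _ _ (projRel_mono (le_max_left n m) h) (projRel_mono (le_max_right n m) h')

theorem projRel_mem {n : ℕ} {u v : F} (h : projRel ℓ W n u v) : v ∈ W := by
  induction n generalizing u with
  | zero => exact h.2 ▸ h.1
  | succ n ih =>
    rcases h with h | ⟨-, k, hk, -⟩
    · exact ih h
    · exact ih hk

/-- Induction along a walk from `u` to `W`. The letters are closed under inverses, so each edge of
the walk is left multiplication by a letter in either direction. -/
theorem projRel_total (hinv : ∀ n, ∃ m, ℓ m * ℓ n = 1) (hconn : (leftCayley ℓ).Preconnected)
    (hW : W.Nonempty) (u : F) : ∃ n v, projRel ℓ W n u v := by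
  classical
  obtain ⟨w, hw⟩ := hW
  have step : ∀ u k, (∃ n v, projRel ℓ W n (ℓ k * u) v) → ∃ n v, projRel ℓ W n u v := by
    rintro u k ⟨n, v, h⟩
    by_cases hu : ∃ v', projRel ℓ W n u v'
    · exact ⟨n, hu⟩
    have hex : ∃ k v, projRel ℓ W n (ℓ k * u) v := ⟨k, v, h⟩
    obtain ⟨v', hv'⟩ := Nat.find_spec hex
    exact ⟨n + 1, v', .inr ⟨not_exists.1 hu, _, hv', fun j hj => not_exists.1 (Nat.find_min hex hj)⟩⟩
  obtain ⟨p⟩ := hconn u w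
  induction p with
  | nil => exact ⟨0, _, hw, rfl⟩
  | @cons a b c h p ih =>
    obtain ⟨-, ⟨k, hk⟩ | ⟨k, hk⟩⟩ := h
    · exact step a k (hk ▸ ih hw)
    · obtain ⟨m, hm⟩ := hinv k
      refine step a m ?_
      rw [hk, ← mul_assoc, hm, one_mul]
      exact ih hw

/-- The projection is built from left multiplications and an ordering of the letters, both untouched
by right translation. -/
theorem projRel_mul_right (g : F) {W' : Set F} (hW' : ∀ u, u * g ∈ W' ↔ u ∈ W) (n : ℕ) (u v : F) :
    projRel ℓ W' n (u * g) (v * g) ↔ projRel ℓ W n u v := by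
  induction n generalizing u v with
  | zero => simp only [projRel, hW', mul_left_inj]
  | succ n ih =>
    have hall : ∀ u, (∀ v', ¬ projRel ℓ W' n (u * g) v') ↔ ∀ v', ¬ projRel ℓ W n u v' := by
      intro u
      constructor
      · intro h v' hv'
        exact h _ ((ih u v').2 hv')
      · intro h v' hv'
        refine h (v' * g⁻¹) ((ih _ _).1 ?_)
        rwa [inv_mul_cancel_right]
    simp only [projRel, ih, ← mul_assoc, hall]

/-- All quantifiers in `projRel` range over `F` and `ℕ`, which are countable. -/
theorem measurableSet_projRel {Ω : Type*} [MeasurableSpace Ω] {V : Ω → Set F}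
    (hV : ∀ u, MeasurableSet {ω | u ∈ V ω}) [Countable F] (n : ℕ) (u v : F) :
    MeasurableSet {ω | projRel ℓ (V ω) n u v} := by
  induction n generalizing u v with
  | zero => exact (hV u).inter (.const _)
  | succ n ih =>
    have hall : ∀ u, MeasurableSet {ω | ∀ v', ¬ projRel ℓ (V ω) n u v'} := by
      intro u
      simp only [Set.ofPred_forall]
      exact .iInter fun v' => (ih u v').compl
    refine (ih u v).union ((hall u).inter ?_)
    change MeasurableSet {ω | ∃ k, projRel ℓ (V ω) n (ℓ k * u) v ∧
      ∀ j < k, ∀ v', ¬ projRel ℓ (V ω) n (ℓ j * u) v'}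
    simp only [Set.ofPred_exists]
    refine .iUnion fun k => (ih _ v).inter ?_
    change MeasurableSet {ω | ∀ j < k, ∀ v', ¬ projRel ℓ (V ω) n (ℓ j * u) v'}
    simp only [Set.ofPred_forall]
    exact .iInter fun j => .iInter fun _ => .iInter fun v' => (ih _ v').compl

/-- The graph on `W` obtained from the Cayley graph by contracting the fibers of the nearest point
projection. -/
def contractedGraph (ℓ : ℕ → F) (W : Set F) : SimpleGraph F :=
  SimpleGraph.fromRel fun a b => ∃ u k n m, projRel ℓ W n u a ∧ projRel ℓ W m (ℓ k * u) b

theorem contractedGraph_mem {a b : F} (h : (contractedGraph ℓ W).Adj a b) : a ∈ W ∧ b ∈ W := by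
  obtain ⟨-, ⟨u, k, n, m, h₁, h₂⟩ | ⟨u, k, n, m, h₁, h₂⟩⟩ := h
  · exact ⟨projRel_mem h₁, projRel_mem h₂⟩
  · exact ⟨projRel_mem h₂, projRel_mem h₁⟩

theorem contractedGraph_mul_right (g : F) {W' : Set F} (hW' : ∀ u, u * g ∈ W' ↔ u ∈ W) (a b : F) :
    (contractedGraph ℓ W').Adj (a * g) (b * g) ↔ (contractedGraph ℓ W).Adj a b := by
  have key : ∀ a b, (∃ u k n m, projRel ℓ W' n u (a * g) ∧ projRel ℓ W' m (ℓ k * u) (b * g)) ↔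
      ∃ u k n m, projRel ℓ W n u a ∧ projRel ℓ W m (ℓ k * u) b := by
    intro a b
    rw [(mul_right_surjective g).exists]
    simp only [← mul_assoc, projRel_mul_right g hW']
  simp only [contractedGraph, SimpleGraph.fromRel_adj, key, ne_eq, mul_left_inj]

theorem measurableSet_contractedGraph {Ω : Type*} [MeasurableSpace Ω] {V : Ω → Set F}
    (hV : ∀ u, MeasurableSet {ω | u ∈ V ω}) [Countable F] (a b : F) :
    MeasurableSet {ω | (contractedGraph ℓ (V ω)).Adj a b} := by
  have key : ∀ a b, MeasurableSet {ω | ∃ u k n m, projRel ℓ (V ω) n u a ∧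
      projRel ℓ (V ω) m (ℓ k * u) b} := by
    intro a b
    simp only [Set.ofPred_exists]
    exact .iUnion fun u => .iUnion fun k => .iUnion fun n => .iUnion fun m =>
      (measurableSet_projRel hV n _ _).inter (measurableSet_projRel hV m _ _)
  exact (MeasurableSet.const _).inter ((key a b).union (key b a))

/-- The projection carries each edge of a Cayley walk to an edge or to a single vertex, and it fixes
the points of `W`. -/
theorem contractedGraph_reachable (hinv : ∀ n, ∃ m, ℓ m * ℓ n = 1)
    (hconn : (leftCayley ℓ).Preconnected) {a b : F} (ha : a ∈ W) (hb : b ∈ W) :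
    (contractedGraph ℓ W).Reachable a b := by
  have key : ∀ u v, (leftCayley ℓ).Reachable u v → ∀ n m a b, projRel ℓ W n u a →
      projRel ℓ W m v b → (contractedGraph ℓ W).Reachable a b := by
    rintro u v ⟨p⟩
    induction p with
    | nil =>
      intro n m a b h h'
      rw [projRel_unique h h']
    | @cons u x v h p ih =>
      intro n m a b h₁ h₂
      obtain ⟨j, c, hc⟩ := projRel_total hinv hconn ⟨_, ha⟩ x
      refine SimpleGraph.Reachable.trans ?_ (ih j m c b hc h₂)
      rcases eq_or_ne a c with rfl | hac
      · rfl
      refine SimpleGraph.Adj.reachable ⟨hac, ?_⟩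
      obtain ⟨-, ⟨k, rfl⟩ | ⟨k, rfl⟩⟩ := h
      · exact .inl ⟨u, k, n, j, h₁, hc⟩
      · exact .inr ⟨x, k, j, n, hc, h₁⟩
  exact key a b (hconn a b) 0 0 a b ⟨ha, rfl⟩ ⟨hb, rfl⟩

/-- Every edge is a bridge. An edge `ab` comes from a Cayley edge between the fibers over `a` and
`b`. A detour from `a` to `b` avoiding `ab` would lift, through the connected fibers, to a detour
around that Cayley edge, which is itself a bridge. -/
theorem contractedGraph_isAcyclic (hacyc : (leftCayley ℓ).IsAcyclic) :
    (contractedGraph ℓ W).IsAcyclic := by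
  rw [SimpleGraph.isAcyclic_iff_forall_adj_isBridge] at hacyc ⊢
  have main : ∀ a b, a ≠ b → (∃ u k n m, projRel ℓ W n u a ∧ projRel ℓ W m (ℓ k * u) b) →
      (contractedGraph ℓ W).IsBridge s(a, b) := by
    rintro a b hab ⟨u, k, n, m, hu, hv⟩
    rw [SimpleGraph.isBridge_iff]
    have huv : u ≠ ℓ k * u := by
      intro h
      rw [← h] at hv
      exact hab (projRel_unique hu hv)
    have hbr := SimpleGraph.isBridge_iff.1 (hacyc (v := u) (w := ℓ k * u) ⟨huv, .inl ⟨k, rfl⟩⟩)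
    intro hreach
    set D := (leftCayley ℓ).deleteEdges {s(u, ℓ k * u)} with hD
    have hDadj : ∀ x y j, y = ℓ j * x → x ≠ y → ∀ n m c d, projRel ℓ W n x c →
        projRel ℓ W m y d → s(c, d) ≠ s(a, b) → D.Reachable x y := by
      intro x y j hy hxy n' m' c d hc hd hne
      refine SimpleGraph.Adj.reachable ?_
      rw [hD, SimpleGraph.deleteEdges_adj, Set.mem_singleton_iff]
      refine ⟨⟨hxy, .inl ⟨j, hy⟩⟩, fun h => hne ?_⟩
      rcases Sym2.eq_iff.1 h with ⟨rfl, rfl⟩ | ⟨rfl, rfl⟩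
      · rw [projRel_unique hc hu, projRel_unique hd hv]
      · rw [projRel_unique hc hv, projRel_unique hd hu, Sym2.eq_swap]
    -- Fibers stay connected in `D`: each projection step joins two points with the same image,
    -- whereas the deleted edge joins points with the distinct images `a` and `b`.
    have hfib : ∀ n x c, projRel ℓ W n x c → D.Reachable x c := by
      intro n
      induction n with
      | zero => rintro x c ⟨-, rfl⟩; rfl
      | succ n ih =>
        rintro x c (h | ⟨hn, j, hj, hlt⟩)
        · exact ih x c h
        · refine SimpleGraph.Reachable.trans ?_ (ih _ c hj)
          rcases eq_or_ne x (ℓ j * x) with h | h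
          · rw [← h]
          · refine hDadj x _ j rfl h (n + 1) n c c (.inr ⟨hn, j, hj, hlt⟩) hj ?_
            intro h'
            rcases Sym2.eq_iff.1 h' with ⟨rfl, h''⟩ | ⟨rfl, h''⟩
            · exact hab h''
            · exact hab h''.symm
    have hlift : ∀ c d, ((contractedGraph ℓ W).deleteEdges {s(a, b)}).Reachable c d →
        ∀ n m x y, projRel ℓ W n x c → projRel ℓ W m y d → D.Reachable x y := by
      rintro c d ⟨p⟩
      induction p with
      | nil =>
        intro n m x y hx hy
        exact (hfib _ _ _ hx).trans (hfib _ _ _ hy).symm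
      | @cons c e d h p ih =>
        intro n m x y hx hy
        rw [SimpleGraph.deleteEdges_adj, Set.mem_singleton_iff] at h
        obtain ⟨⟨hce, h⟩, hne⟩ := h
        have hxx : ∀ n' z, projRel ℓ W n' z c → D.Reachable x z := fun n' z hz =>
          (hfib _ _ _ hx).trans (hfib _ _ _ hz).symm
        rcases h with ⟨z, j, n', m', hz, hz'⟩ | ⟨z, j, n', m', hz, hz'⟩
        · refine (hxx _ _ hz).trans (SimpleGraph.Reachable.trans ?_ (ih m' m (ℓ j * z) y hz' hy))
          exact hDadj z _ j rfl (fun h => hce (projRel_unique hz (h.symm ▸ hz'))) _ _ c e hz hz' hne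
        · refine (hxx _ _ hz').trans (SimpleGraph.Reachable.trans ?_ (ih n' m z y hz hy))
          exact (hDadj z _ j rfl (fun h => hce (projRel_unique (h.symm ▸ hz') hz)) _ _ e c hz hz'
            (Sym2.eq_swap ▸ hne)).symm
    exact hbr (hlift a b hreach n m u _ hu hv)
  rintro a b ⟨hab, h | h⟩
  · exact main a b hab h
  · rw [Sym2.eq_swap]
    exact main b a hab.symm h

end NearestPoint

/-! ### The Cayley graph of the free group is a tree. -/

section FreeGroup

/-- An enumeration of the letters and their formal inverses. -/
noncomputable def letterIndex : ℕ → ℕ × Bool := (exists_surjective_nat (ℕ × Bool)).choose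

/-- An enumeration of the generators of the free group on `ℕ` and of their inverses. -/
noncomputable def letter (n : ℕ) : FreeGroup ℕ := FreeGroup.mk [letterIndex n]

theorem exists_letter (x : ℕ × Bool) : ∃ n, letter n = FreeGroup.mk [x] := by
  obtain ⟨n, hn⟩ := (exists_surjective_nat (ℕ × Bool)).choose_spec x
  exact ⟨n, congrArg (fun y => FreeGroup.mk [y]) hn⟩

theorem letter_inv (n : ℕ) : ∃ m, letter m * letter n = 1 := by
  obtain ⟨m, hm⟩ := exists_letter ((letterIndex n).1, !(letterIndex n).2)
  refine ⟨m, ?_⟩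
  rw [hm, letter, FreeGroup.mul_mk, List.singleton_append]
  exact Quot.sound FreeGroup.Red.Step.cons_not_rev

theorem leftCayley_letter_preconnected : (leftCayley letter).Preconnected := by
  have key : ∀ L, (leftCayley letter).Reachable (FreeGroup.mk L) 1 := by
    intro L
    induction L with
    | nil => rfl
    | cons x L ih =>
      refine SimpleGraph.Reachable.trans ?_ ih
      obtain ⟨n, hn⟩ := exists_letter x
      have : FreeGroup.mk (x :: L) = letter n * FreeGroup.mk L := by
        rw [hn, FreeGroup.mul_mk, List.singleton_append]
      rw [this]
      rcases eq_or_ne (letter n * FreeGroup.mk L) (FreeGroup.mk L) with h | h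
      · rw [h]
      · exact SimpleGraph.Adj.reachable ⟨h, .inr ⟨n, rfl⟩⟩
  intro u v
  rw [← u.mk_toWord, ← v.mk_toWord]
  exact (key _).trans (key _).symm

/-- Left multiplication by a letter changes a reduced word only at its front. It affects whether the
last letter is `l` only in passing between the empty word and `[l]`, which the hypotheses exclude.
-/
theorem getLast_toWord_letter_mul (x l : ℕ × Bool) (g : FreeGroup ℕ)
    (h : ¬ (g = 1 ∧ x = l)) (h' : ¬ (g = FreeGroup.mk [l] ∧ FreeGroup.mk [x] * g = 1)) :
    (FreeGroup.mk [x] * g).toWord.getLast? = some l ↔ g.toWord.getLast? = some l := by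
  have e : (FreeGroup.mk [x] * g).toWord = FreeGroup.reduce (x :: g.toWord) := by
    conv_lhs => rw [← g.mk_toWord, FreeGroup.mul_mk, List.singleton_append, FreeGroup.toWord_mk]
  rw [FreeGroup.reduce.cons, FreeGroup.reduce_toWord] at e
  have h₁ : ¬ (g.toWord = [] ∧ x = l) := by rwa [FreeGroup.toWord_eq_nil_iff]
  have h₂ : ¬ (g.toWord = [l] ∧ (FreeGroup.mk [x] * g).toWord = []) := by
    rw [FreeGroup.toWord_eq_nil_iff]
    rintro ⟨h₃, h₄⟩
    exact h' ⟨by rw [← g.mk_toWord, h₃], h₄⟩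
  rw [e] at h₂ ⊢
  generalize g.toWord = L at h₁ h₂
  cases L with
  | nil => simpa using h₁
  | cons hd tl =>
    dsimp only at h₂ ⊢
    split_ifs with hc
    · rw [if_pos hc] at h₂
      cases tl with
      | nil => simpa using h₂
      | cons hd' tl => rw [List.getLast?_cons_cons]
    · rw [List.getLast?_cons_cons]

/-- The edge from `u` to `letter n * u` is the only one joining the vertices `x` for which `x * u⁻¹`
ends in the letter `l` to the others, so it is a bridge. -/
theorem leftCayley_letter_isAcyclic : (leftCayley letter).IsAcyclic := by
  rw [SimpleGraph.isAcyclic_iff_forall_adj_isBridge]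
  have main : ∀ u n, (leftCayley letter).IsBridge s(u, letter n * u) := by
    intro u n
    rw [SimpleGraph.isBridge_iff]
    set l := letterIndex n with hl
    have hln : letter n = FreeGroup.mk [l] := rfl
    have hadj : ∀ x y, ((leftCayley letter).deleteEdges {s(u, letter n * u)}).Adj x y →
        ((x * u⁻¹).toWord.getLast? = some l ↔ (y * u⁻¹).toWord.getLast? = some l) := by
      have key : ∀ x k, s(x, letter k * x) ≠ s(u, letter n * u) →
          ((letter k * x * u⁻¹).toWord.getLast? = some l ↔
            (x * u⁻¹).toWord.getLast? = some l) := by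
        intro x k hne
        rw [mul_assoc]
        refine getLast_toWord_letter_mul _ l _ ?_ ?_
        · rintro ⟨h1, h2⟩
          rw [mul_inv_eq_one] at h1
          refine hne ?_
          rw [h1, hln, ← h2]
          rfl
        · rintro ⟨h1, h2⟩
          rw [← mul_assoc, mul_inv_eq_one] at h2
          rw [mul_inv_eq_iff_eq_mul] at h1
          refine hne ?_
          rw [h1, hln, Sym2.eq_swap, ← h1]
          exact congrArg (fun z => s(z, x)) h2
      intro x y h
      rw [SimpleGraph.deleteEdges_adj, Set.mem_singleton_iff] at h
      obtain ⟨⟨-, ⟨k, rfl⟩ | ⟨k, rfl⟩⟩, hne⟩ := h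
      · exact (key x k hne).symm
      · exact key y k (by rwa [Sym2.eq_swap])
    rintro ⟨p⟩
    have hinv : ∀ x y, ((leftCayley letter).deleteEdges {s(u, letter n * u)}).Walk x y →
        ((x * u⁻¹).toWord.getLast? = some l ↔ (y * u⁻¹).toWord.getLast? = some l) := by
      intro x y q
      induction q with
      | nil => rfl
      | cons h q ih => exact (hadj _ _ h).trans ih
    have := hinv _ _ p
    rw [mul_inv_cancel, mul_inv_cancel_right, hln, FreeGroup.toWord_mk, FreeGroup.reduce_singleton,
      FreeGroup.toWord_one] at this
    simp at this
  rintro u v ⟨-, ⟨k, rfl⟩ | ⟨k, rfl⟩⟩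
  · exact main u k
  · rw [Sym2.eq_swap]
    exact main v k

end FreeGroup

/-! ### From a free-group cocycle to a treeing. -/

section CocycleTreeing

/-- The cocycle places each class injectively in the free group, up to right translation. The
contracted Cayley tree on the image is translation equivariant, so its pullback to the class does
not depend on the base point. -/
theorem isTreeable_of_cocycle {X : Type u} [MeasurableSpace X] {R : Setoid X} {μ : Measure X}
    {A : Set X} (hA0 : μ Aᶜ = 0) (hAR : ∀ x y, R x y → (x ∈ A ↔ y ∈ A))
    (φ : FreeGroup ℕ →* Equiv.Perm X) (hφ : ∀ w, Measurable (φ w)) (hφR : ∀ w x, R (φ w x) x)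
    (c : X → X → FreeGroup ℕ)
    (hcφ : ∀ x ∈ A, ∀ y ∈ A, R x y → φ (c x y) y = x)
    (hcc : ∀ x ∈ A, ∀ y ∈ A, ∀ z ∈ A, R x y → R y z → c x y * c y z = c x z)
    (hcm : ∀ w, MeasurableSet {p : X × X | p.1 ∈ A ∧ p.2 ∈ A ∧ R p.1 p.2 ∧ c p.1 p.2 = w}) :
    IsTreeable R μ := by
  have : Countable (FreeGroup ℕ) := FreeGroup.toWord_injective.countable
  -- For `y ∈ A`, this is the image of the class of `y` under `x ↦ c x y`, written so that
  -- membership of `w` is a Borel condition on `y`.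
  let V (y : X) : Set (FreeGroup ℕ) := {w | y ∈ A ∧ c (φ w y) y = w}
  have hVm : ∀ w, MeasurableSet {y | w ∈ V y} := by
    intro w
    have : {y | w ∈ V y} = (fun y => (φ w y, y)) ⁻¹'
        {p : X × X | p.1 ∈ A ∧ p.2 ∈ A ∧ R p.1 p.2 ∧ c p.1 p.2 = w} := by
      ext y
      constructor
      · rintro ⟨hy, h⟩
        exact ⟨(hAR _ _ (hφR w y)).2 hy, hy, hφR w y, h⟩
      · rintro ⟨-, hy, -, h⟩
        exact ⟨hy, h⟩
    rw [this]
    exact (hφ w).prodMk measurable_id (hcm w)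
  have hc1 : ∀ x ∈ A, c x x = 1 := fun x hx => by
    simpa using hcc x hx x hx x hx (R.refl x) (R.refl x)
  have hcV : ∀ x ∈ A, ∀ y ∈ A, R x y → c x y ∈ V y := fun x hx y hy h =>
    ⟨hy, by rw [hcφ x hx y hy h]⟩
  have hVmul : ∀ x ∈ A, ∀ y ∈ A, R x y → ∀ w, w * c x y ∈ V y ↔ w ∈ V x := by
    intro x hx y hy h w
    have h1 : φ (w * c x y) y = φ w x := by
      rw [map_mul, Equiv.Perm.mul_apply, hcφ x hx y hy h]
    have h2 : φ w x ∈ A := (hAR _ _ (hφR w x)).2 hx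
    change (y ∈ A ∧ c (φ (w * c x y) y) y = w * c x y) ↔ (x ∈ A ∧ c (φ w x) x = w)
    rw [h1, ← hcc _ h2 x hx y hy (hφR w x) h, mul_left_inj]
    simp only [hx, hy]
  have hadj : ∀ x ∈ A, ∀ y ∈ A, R x y → ∀ a b,
      (contractedGraph letter (V y)).Adj (a * c x y) (b * c x y) ↔
        (contractedGraph letter (V x)).Adj a b := fun x hx y hy h a b =>
    contractedGraph_mul_right _ (hVmul x hx y hy h) a b
  let T : SimpleGraph X :=
    -- Adjacency is read with base point `y`, where `y` itself corresponds to `c y y = 1`.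
    { Adj := fun x y => x ∈ A ∧ y ∈ A ∧ R x y ∧ (contractedGraph letter (V y)).Adj (c x y) 1
      symm := ⟨fun x y ⟨hx, hy, h, he⟩ => by
        refine ⟨hy, hx, R.symm h, ?_⟩
        have := (hadj y hy x hx (R.symm h) (c x y) 1).2 he
        rw [hcc x hx y hy x hx h (R.symm h), hc1 x hx, one_mul] at this
        exact this.symm⟩
      loopless := ⟨fun x ⟨hx, _, _, he⟩ => by
        rw [hc1 x hx] at he
        exact he.ne rfl⟩ }
  have hTadj : ∀ x ∈ A, ∀ y ∈ A, ∀ z ∈ A, R x z → R y z →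
      (T.Adj x y ↔ (contractedGraph letter (V z)).Adj (c x z) (c y z)) := by
    intro x hx y hy z hz hxz hyz
    have hxy := R.trans hxz (R.symm hyz)
    rw [← hcc x hx y hy z hz hxy hyz]
    nth_rewrite 2 [← one_mul (c y z)]
    rw [hadj y hy z hz hyz]
    exact ⟨fun h => h.2.2.2, fun h => ⟨hx, hy, hxy, h⟩⟩
  have hreach : ∀ x ∈ A, ∀ y, R y x → T.Reachable y x := by
    intro x hx y hyx
    have hφA : ∀ w, φ w x ∈ A := fun w => (hAR _ _ (hφR w x)).2 hx
    have hy := (hAR _ _ hyx).2 hx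
    have key : ∀ u v, (contractedGraph letter (V x)).Walk u v → T.Reachable (φ u x) (φ v x) := by
      intro u v p
      induction p with
      | nil => rfl
      | @cons u v w h p ih =>
        refine SimpleGraph.Reachable.trans (SimpleGraph.Adj.reachable ?_) ih
        rw [hTadj _ (hφA u) _ (hφA v) x hx (hφR u x) (hφR v x), (contractedGraph_mem h).1.2,
          (contractedGraph_mem h).2.2]
        exact h
    obtain ⟨p⟩ := contractedGraph_reachable letter_inv leftCayley_letter_preconnected
      (hcV y hy x hx hyx) (hcV x hx x hx (R.refl x))
    have := key _ _ p
    rwa [hcφ y hy x hx hyx, hcφ x hx x hx (R.refl x)] at this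
  refine ⟨T, ?_, fun x y h => h.2.2.1, ?_⟩
  · have : {p : X × X | T.Adj p.1 p.2} = ⋃ w, {p : X × X | p.1 ∈ A ∧ p.2 ∈ A ∧ R p.1 p.2 ∧
        c p.1 p.2 = w} ∩ Prod.snd ⁻¹' {y | (contractedGraph letter (V y)).Adj w 1} := by
      ext ⟨x, y⟩
      rw [Set.mem_iUnion]
      constructor
      · rintro ⟨hx, hy, h, he⟩
        exact ⟨c x y, ⟨hx, hy, h, rfl⟩, he⟩
      · rintro ⟨_, ⟨hx, hy, h, rfl⟩, he⟩
        exact ⟨hx, hy, h, he⟩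
    rw [this]
    exact .iUnion fun w => (hcm w).inter (measurable_snd (measurableSet_contractedGraph hVm w 1))
  · have : ∀ᵐ x ∂μ, x ∈ A := hA0
    filter_upwards [this] with x hx
    have hsupp : (T.connectedComponentMk x).supp = {y : X | R y x} := by
      ext y
      refine ⟨fun h => ?_, fun h => SimpleGraph.ConnectedComponent.sound (hreach x hx y h)⟩
      obtain ⟨p⟩ := SimpleGraph.ConnectedComponent.exact h
      clear h hx
      induction p with
      | nil => exact R.refl _
      | cons h p ih => exact R.trans h.2.2.1 ih
    refine ⟨⟨SimpleGraph.ConnectedComponent.connected_toSimpleGraph _, ?_⟩, hsupp⟩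
    have hmem : ∀ y : (T.connectedComponentMk x).supp, R y.1 x ∧ y.1 ∈ A := by
      intro y
      have : R y.1 x := (Set.ext_iff.1 hsupp y.1).1 y.2
      exact ⟨this, (hAR _ _ this).2 hx⟩
    -- An injective homomorphism into an acyclic graph; it is injective because `c y x` carries `x`
    -- back to `y`.
    let f : (T.connectedComponentMk x).toSimpleGraph →g contractedGraph letter (V x) :=
      { toFun := fun y => c y.1 x
        map_rel' := fun {y z} h => (hTadj _ (hmem y).2 _ (hmem z).2 x hx (hmem y).1 (hmem z).1).1 h }
    refine (contractedGraph_isAcyclic leftCayley_letter_isAcyclic).comap f fun y z h => ?_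
    have h' : c y.1 x = c z.1 x := h
    refine Subtype.ext ?_
    rw [← hcφ _ (hmem y).2 x hx (hmem y).1, h', hcφ _ (hmem z).2 x hx (hmem z).1]

end CocycleTreeing

/-! ### Action groupoids of countable groups as measured groupoids. -/

section ActionGroupoid

/-- Used with the fibers of source and target, each parametrized injectively by the group, to turn
`μ_s` and `μ_t` into countable sums. -/
theorem count_restrict_range_eq_sum_dirac {ι G : Type*} [MeasurableSpace G]
    [MeasurableSingletonClass G] {a : ι → G} (ha : Function.Injective a) :
    Measure.count.restrict (Set.range a) = Measure.sum fun w => Measure.dirac (a w) := by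
  let _ : MeasurableSpace ι := ⊤
  ext E hE
  have h1 : E ∩ Set.range a = a '' (a ⁻¹' E) := Set.image_preimage_eq_inter_range.symm
  rw [Measure.restrict_apply hE, Measure.sum_apply _ hE, h1, Measure.count_injective_image ha,
    Measure.count, Measure.sum_apply _ MeasurableSpace.measurableSet_top]
  refine tsum_congr fun w => ?_
  rw [Measure.dirac_apply' _ MeasurableSpace.measurableSet_top, Measure.dirac_apply' _ hE]
  rfl

theorem bind_sum_dirac_apply {X ι G : Type*} [Countable ι] [MeasurableSpace X]
    [MeasurableSpace G] {a : ι → X → G}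
    (ha : ∀ w, Measurable (a w)) (μ : Measure X) {E : Set G} (hE : MeasurableSet E) :
    (μ.bind fun x => Measure.sum fun w => Measure.dirac (a w x)) E =
      ∑' w, μ (a w ⁻¹' E) := by
  have hm : ∀ w, Measurable fun x => Measure.dirac (a w x) E := by
    intro w
    simp only [Measure.dirac_apply' _ hE]
    exact (measurable_one.indicator hE).comp (ha w)
  rw [Measure.bind_apply hE]
  · simp only [Measure.sum_apply _ hE]
    rw [lintegral_tsum fun w => (hm w).aemeasurable]
    refine tsum_congr fun w => ?_
    simp only [Measure.dirac_apply' _ hE]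
    exact lintegral_indicator_one (ha w hE)
  · refine (Measure.measurable_of_measurable_coe _ fun E hE => ?_).aemeasurable
    simp only [Measure.sum_apply _ hE, Measure.dirac_apply' _ hE]
    exact Measurable.tsum fun w => (measurable_one.indicator hE).comp (ha w)

variable {X : Type u} {F : Type} [Group F]

/-- The groupoid of an action of `F` on `X`: the arrow `(x, w)` has source `x` and target `w x`. -/
def actionGroupoid (φ : F →* Equiv.Perm X) : ArrowGroupoid X (X × F) where
  src g := g.1
  tgt g := φ g.2 g.1
  unit x := (x, 1)
  inv g := (φ g.2 g.1, g.2⁻¹)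
  mul g h _ := (h.1, g.2 * h.2)
  src_unit _ := rfl
  tgt_unit x := by simp
  src_inv _ := rfl
  tgt_inv g := by simp
  src_mul _ _ _ := rfl
  tgt_mul g h e := by
    rw [map_mul, Equiv.Perm.mul_apply, ← e]
  mul_assoc g h k _ _ := by rw [mul_assoc]
  unit_mul g := by rw [one_mul]
  mul_unit g := by rw [mul_one]
  inv_mul g := by rw [inv_mul_cancel]
  mul_inv g := by
    rw [mul_inv_cancel]

variable [MeasurableSpace X]

variable [Countable F] [MeasurableSpace F] [DiscreteMeasurableSpace F]

theorem actionGroupoid_srcMeasure [MeasurableSingletonClass X] (φ : F →* Equiv.Perm X)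
    (μ : Measure X) {E : Set (X × F)} (hE : MeasurableSet E) :
    (actionGroupoid φ).srcMeasure μ E = ∑' w, μ {x | (x, w) ∈ E} := by
  have : ∀ x, (Measure.count.restrict ((actionGroupoid φ).src ⁻¹' {x}) : Measure (X × F)) =
      Measure.sum fun w => Measure.dirac (x, w) := by
    intro x
    rw [← count_restrict_range_eq_sum_dirac (fun w w' h => congrArg Prod.snd h)]
    congr 1
    ext ⟨y, w⟩
    constructor
    · rintro rfl; exact ⟨w, rfl⟩
    · rintro ⟨w', h⟩; exact (congrArg Prod.fst h).symm
  simp only [ArrowGroupoid.srcMeasure, this]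
  exact bind_sum_dirac_apply (fun w => measurable_id.prodMk measurable_const) μ hE

theorem actionGroupoid_tgtMeasure [MeasurableSingletonClass X] (φ : F →* Equiv.Perm X)
    (hφ : ∀ w, Measurable (φ w)) (μ : Measure X) {E : Set (X × F)} (hE : MeasurableSet E) :
    (actionGroupoid φ).tgtMeasure μ E = ∑' w, μ {x | (φ w⁻¹ x, w) ∈ E} := by
  have : ∀ x, (Measure.count.restrict ((actionGroupoid φ).tgt ⁻¹' {x}) : Measure (X × F)) =
      Measure.sum fun w => Measure.dirac (φ w⁻¹ x, w) := by
    intro x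
    rw [← count_restrict_range_eq_sum_dirac (fun w w' h => congrArg Prod.snd h)]
    congr 1
    ext ⟨y, w⟩
    constructor
    · rintro rfl
      exact ⟨w, Prod.ext (by simp [actionGroupoid]) rfl⟩
    · rintro ⟨w', h⟩
      obtain ⟨rfl, rfl⟩ := Prod.ext_iff.1 h
      simp [actionGroupoid]
  simp only [ArrowGroupoid.tgtMeasure, this]
  exact bind_sum_dirac_apply (fun w => (hφ w⁻¹).prodMk measurable_const) μ hE

/-- The action groupoid of a Borel action of a countable group whose orbits are contained in the
classes of a nonsingular equivalence relation. -/
def actionMeasuredGroupoid [StandardBorelSpace X] {R : Setoid X} {μ : Measure X}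
    (hR : IsCountableNonsingular R μ) (φ : F →* Equiv.Perm X) (hφ : ∀ w, Measurable (φ w))
    (hφR : ∀ w x, R (φ w x) x) : DiscreteMeasuredGroupoid X (X × F) μ where
  toArrowGroupoid := actionGroupoid φ
  standardBorel := inferInstance
  measurableEmbedding_unit := by
    refine Measurable.measurableEmbedding (measurable_id.prodMk measurable_const) ?_
    exact fun x y h => congrArg Prod.fst h
  measurable_src := measurable_fst
  measurable_tgt := measurable_from_prod_countable_left hφ
  countable_src_fiber x := by
    refine (Set.countable_range fun w : F => (x, w)).mono ?_
    rintro ⟨y, w⟩ rfl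
    exact ⟨w, rfl⟩
  countable_tgt_fiber x := by
    refine (Set.countable_range fun w : F => (φ w⁻¹ x, w)).mono ?_
    rintro ⟨y, w⟩ rfl
    exact ⟨w, Prod.ext (by simp [actionGroupoid]) rfl⟩
  measurable_mul := by
    have : Measurable fun p : F × F => p.1 * p.2 := .of_discrete
    exact (measurable_fst.comp (measurable_snd.comp measurable_subtype_coe)).prodMk
      (this.comp ((measurable_snd.comp (measurable_fst.comp measurable_subtype_coe)).prodMk
        (measurable_snd.comp (measurable_snd.comp measurable_subtype_coe))))
  measurable_inv := (measurable_from_prod_countable_left hφ).prodMk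
    ((Measurable.of_discrete (f := fun w : F => w⁻¹)).comp measurable_snd)
  srcMeasure_absolutelyContinuous := by
    refine Measure.AbsolutelyContinuous.mk fun E hE h => ?_
    rw [actionGroupoid_tgtMeasure φ hφ μ hE, ENNReal.tsum_eq_zero] at h
    rw [actionGroupoid_srcMeasure φ μ hE, ENNReal.tsum_eq_zero]
    intro w
    -- The slice of `E` at `w` used by `μ_s` lies in the saturation of the one used by `μ_t`,
    -- because `φ w x` is equivalent to `x`.
    refine measure_mono_null ?_ (hR.null_saturation _
      (((hφ w⁻¹).prodMk measurable_const) hE) (h w))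
    intro x hx
    exact ⟨φ w x, by simpa using hx, R.symm (hφR w x)⟩
  tgtMeasure_absolutelyContinuous := by
    refine Measure.AbsolutelyContinuous.mk fun E hE h => ?_
    rw [actionGroupoid_srcMeasure φ μ hE, ENNReal.tsum_eq_zero] at h
    rw [actionGroupoid_tgtMeasure φ hφ μ hE, ENNReal.tsum_eq_zero]
    intro w
    refine measure_mono_null ?_ (hR.null_saturation _
      ((measurable_id.prodMk measurable_const) hE) (h w))
    intro x hx
    exact ⟨φ w⁻¹ x, hx, R.symm (hφR w⁻¹ x)⟩

end ActionGroupoid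

/-! ### Sections from splittings. -/

namespace ArrowGroupoid

/-- A strict semidirect product has a Borel homomorphic section over `R`. -/
theorem IsStrictSemidirectProduct.exists_section {X G : Type u} [MeasurableSpace X]
    [MeasurableSpace G] {𝒢 : ArrowGroupoid X G} {R : Setoid X}
    (h : 𝒢.IsStrictSemidirectProduct R) (hu : Measurable 𝒢.unit) :
    ∃ θ : {p : X × X // R p.1 p.2} → G, Measurable θ ∧ (∀ p, 𝒢.tgt (θ p) = p.1.1) ∧
      (∀ p, 𝒢.src (θ p) = p.1.2) ∧ ∀ x y z (hxy : R x y) (hyz : R y z) e,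
        𝒢.mul (θ ⟨(x, y), hxy⟩) (θ ⟨(y, z), hyz⟩) e = θ ⟨(x, z), R.trans hxy hyz⟩ := by
  obtain ⟨δ, Φ, -⟩ := h
  refine ⟨fun p => Φ.toEquiv (SemidirectArrow.mk p.1.1 p.1.2 p.2 1), ?_, fun p => Φ.tgt_map _,
    fun p => Φ.src_map _, fun x y z hxy hyz e => ?_⟩
  · refine Φ.toEquiv.measurable.comp (Measurable.subtype_mk (measurable_subtype_coe.prodMk ?_))
    exact hu.comp (measurable_fst.comp measurable_subtype_coe)
  · rw [← Φ.map_mul _ _ rfl]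
    congr 1
    exact SemidirectArrow.mk_congr (h := R.trans hxy hyz) rfl
      ((congrArg ((1 : 𝒢.Isotropy x) * ·) (map_one (δ.map x y hxy))).trans (mul_one (1 : 𝒢.Isotropy x)))

end ArrowGroupoid

/-! ### Splitting of the free-group action groupoid implies treeability. -/

section Converse

/-- It suffices to split one groupoid: the action groupoid of a free group whose orbits are the
classes. The group component of the section is the required cocycle. -/
theorem IsCountableNonsingular.isTreeable_of_forall_isSemidirectProduct {X : Type u}
    [MeasurableSpace X] [StandardBorelSpace X] {μ : Measure X} {R : Setoid X}
    (hR : IsCountableNonsingular R μ)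
    (h : ∀ (G : Type u) [MeasurableSpace G] (𝒢 : DiscreteMeasuredGroupoid X G μ),
        (∀ x y : X, R x y ↔ ∃ g : G, 𝒢.tgt g = x ∧ 𝒢.src g = y) →
          𝒢.toArrowGroupoid.IsSemidirectProduct R μ) : IsTreeable R μ := by
  have : Countable (FreeGroup ℕ) := FreeGroup.toWord_injective.countable
  let _ : MeasurableSpace (FreeGroup ℕ) := ⊤
  obtain ⟨e, heR, he⟩ := exists_measurableEquiv_generating hR.measurableSet_rel hR.countable_class
  let φ : FreeGroup ℕ →* Equiv.Perm X := FreeGroup.lift fun n => (e n).toEquiv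
  have hof : ∀ n, φ (.of n) = (e n).toEquiv := fun n => FreeGroup.lift_apply_of
  have hφ : ∀ w, Measurable (φ w) := by
    intro w
    induction w using FreeGroup.induction_on with
    | C1 => rw [map_one]; exact measurable_id
    | of n => rw [hof]; exact (e n).measurable
    | inv_of n _ => rw [map_inv, hof]; exact (e n).symm.measurable
    | mul v w hv hw => rw [map_mul]; exact hv.comp hw
  have hφR : ∀ w x, R (φ w x) x := by
    intro w
    induction w using FreeGroup.induction_on with
    | C1 => rw [map_one]; exact fun x => R.refl x
    | of n => rw [hof]; exact heR n
    | inv_of n _ =>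
      intro x
      rw [map_inv, hof]
      have := heR n ((e n).symm x)
      rw [MeasurableEquiv.apply_symm_apply] at this
      exact R.symm this
    | mul v w hv hw => rw [map_mul]; exact fun x => R.trans (hv _) (hw x)
  obtain ⟨A, hA, hA0, hAR, hs⟩ := h (X × FreeGroup ℕ) (actionMeasuredGroupoid hR φ hφ hφR) (by
    intro x y
    constructor
    · intro hxy
      rcases eq_or_ne x y with rfl | hne
      · exact ⟨(x, 1), (actionGroupoid φ).tgt_unit x, rfl⟩
      · obtain ⟨n, hn⟩ := he x y hxy hne
        refine ⟨(y, .of n), ?_, rfl⟩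
        change φ (.of n) y = x
        rw [hof]
        exact hn
    · rintro ⟨g, rfl, rfl⟩
      exact hφR _ _)
  obtain ⟨θ, hθm, hθt, hθs, hθc⟩ := hs.exists_section
    ((((actionMeasuredGroupoid hR φ hφ hφR).measurableEmbedding_unit.measurable).comp
      measurable_subtype_coe).subtype_mk)
  classical
  -- The section has the form `θ(x, y) = (y, c x y)`. The value `1` elsewhere is arbitrary, as the
  -- cocycle is only used on pairs of `R` in `A`.
  let c (x y : X) : FreeGroup ℕ :=
    if h : x ∈ A ∧ y ∈ A ∧ R x y then (θ ⟨(⟨x, h.1⟩, ⟨y, h.2.1⟩), h.2.2⟩).1.2 else 1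
  have hc : ∀ x y (hx : x ∈ A) (hy : y ∈ A) (h : R x y),
      c x y = (θ ⟨(⟨x, hx⟩, ⟨y, hy⟩), h⟩).1.2 := fun x y hx hy h => dif_pos ⟨hx, hy, h⟩
  refine isTreeable_of_cocycle hA0 hAR φ hφ hφR c ?_ ?_ ?_
  · intro x hx y hy hxy
    rw [hc x y hx hy hxy]
    have h1 := congrArg Subtype.val (hθt ⟨(⟨x, hx⟩, ⟨y, hy⟩), hxy⟩)
    have h2 := congrArg Subtype.val (hθs ⟨(⟨x, hx⟩, ⟨y, hy⟩), hxy⟩)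
    change φ (θ _).1.2 (θ _).1.1 = x at h1
    change (θ _).1.1 = y at h2
    rwa [h2] at h1
  · intro x hx y hy z hz hxy hyz
    rw [hc x y hx hy hxy, hc y z hy hz hyz, hc x z hx hz (R.trans hxy hyz)]
    have := hθc ⟨x, hx⟩ ⟨y, hy⟩ ⟨z, hz⟩ hxy hyz ((hθs ⟨(⟨x, hx⟩, ⟨y, hy⟩), hxy⟩).trans
      (hθt ⟨(⟨y, hy⟩, ⟨z, hz⟩), hyz⟩).symm)
    exact congrArg (fun g => g.1.2) this
  · intro w
    have hD : MeasurableSet {p : X × X | p.1 ∈ A ∧ p.2 ∈ A ∧ R p.1 p.2} :=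
      (measurable_fst hA).inter ((measurable_snd hA).inter hR.measurableSet_rel)
    let ι (p : {p : X × X | p.1 ∈ A ∧ p.2 ∈ A ∧ R p.1 p.2}) :
        {p : A × A // R.comap ((↑) : A → X) p.1 p.2} :=
      ⟨(⟨p.1.1, p.2.1⟩, ⟨p.1.2, p.2.2.1⟩), p.2.2.2⟩
    have hι : Measurable ι :=
      (((measurable_fst.comp measurable_subtype_coe).subtype_mk).prodMk
        ((measurable_snd.comp measurable_subtype_coe).subtype_mk)).subtype_mk
    have hm : Measurable fun p => (θ (ι p)).1.2 :=
      measurable_snd.comp (measurable_subtype_coe.comp (hθm.comp hι))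
    have hset : MeasurableSet {p | (θ (ι p)).1.2 = w} := hm (measurableSet_singleton w)
    convert hD.subtype_image hset using 1
    ext ⟨x, y⟩
    constructor
    · rintro ⟨hx, hy, hxy, rfl⟩
      exact ⟨⟨(x, y), hx, hy, hxy⟩, (hc x y hx hy hxy).symm, rfl⟩
    · rintro ⟨⟨_, hx, hy, hxy⟩, hw, rfl⟩
      exact ⟨hx, hy, hxy, (hc _ _ hx hy hxy).trans hw⟩

end Converse

theorem mainTheorem8 {X : Type u} [MeasurableSpace X] [StandardBorelSpace X]
    (μ : Measure X) [IsProbabilityMeasure μ] (R : Setoid X) (hR : IsCountableNonsingular R μ) :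
    IsTreeable R μ ↔
      ∀ (G : Type u) [MeasurableSpace G] (𝒢 : DiscreteMeasuredGroupoid X G μ),
        (∀ x y : X, R x y ↔ ∃ g : G, 𝒢.tgt g = x ∧ 𝒢.src g = y) →
          𝒢.toArrowGroupoid.IsSemidirectProduct R μ :=
  ⟨fun hT _ _ 𝒢 h𝒢 => hT.isSemidirectProduct hR 𝒢 h𝒢,
    hR.isTreeable_of_forall_isSemidirectProduct⟩
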